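/- Let $M$ be a smooth ($C^\infty$, Hausdorff, second countable, without boundary, not necessarily connected or complete) Riemannian manifold of finite dimension $n$, with metric $\langle\cdot,\cdot\rangle$, Levi-Civita connection $\nabla$ and Riemannian volume measure $dv$. Let $f : M \to \mathbb{R}$ be a $C^2$ function that is convex, i.e. its Hessian $\nabla df$ is nonnegative definite at every point of $M$: $(\nabla df)(v,v) \ge 0$ for every tangent vector $v$. Then for every real $p > 1$ the function $f$ is $p$-subharmonic, i.e. $\operatorname{div}(|df|^{p-2}df) \ge 0$ weakly in $M$: for every nonnegative compactly supported $\varphi \in C^\infty(M)$ the function $\langle |df|^{p-2}df, d\varphi\rangle$ is integrable with respect to $dv$ and $$\int_M \langle |df|^{p-2}df, d\varphi\rangle \, dv \le 0 .$$ Here $|df|^{p-2}df$ is understood to be $0$ at the points where $df = 0$. -/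

import Mathlib

open Bundle MeasureTheory
open scoped Manifold ContDiff

noncomputable section

namespace RiemannianPLaplace

variable {n : ℕ} {M : Type*} [TopologicalSpace M] [ChartedSpace (EuclideanSpace ℝ (Fin n)) M]

/-- The partial derivative `∂ᵢ u` of a function on `ℝⁿ`. -/
def partialDeriv (i : Fin n) (u : EuclideanSpace ℝ (Fin n) → ℝ)
    (y : EuclideanSpace ℝ (Fin n)) : ℝ :=
  fderiv ℝ u y (EuclideanSpace.single i 1)

/-- The coordinate vector field `∂/∂xⁱ` of the chart `e`, at the point with coordinates `y`. -/
def coordVector (e : OpenPartialHomeomorph M (EuclideanSpace ℝ (Fin n)))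
    (y : EuclideanSpace ℝ (Fin n)) (i : Fin n) : TangentSpace (𝓡 n) (e.symm y) :=
  mfderiv (𝓡 n) (𝓡 n) e.symm y
    (EuclideanSpace.single i (1 : ℝ) : EuclideanSpace ℝ (Fin n))

section Metric

variable [RiemannianBundle (fun x : M ↦ TangentSpace (𝓡 n) x)]

/-- The matrix `gᵢⱼ(y) = ⟨∂/∂xⁱ, ∂/∂xʲ⟩` of the Riemannian metric in the chart `e`. -/
def metricMatrix (e : OpenPartialHomeomorph M (EuclideanSpace ℝ (Fin n)))
    (y : EuclideanSpace ℝ (Fin n)) : Matrix (Fin n) (Fin n) ℝ :=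
  Matrix.of fun i j ↦ inner ℝ (coordVector e y i) (coordVector e y j)

/-- The Christoffel symbols `Γᵏᵢⱼ = ½ ∑ₗ gᵏˡ (∂ᵢ gⱼₗ + ∂ⱼ gᵢₗ - ∂ₗ gᵢⱼ)` of the Levi-Civita
connection in the chart `e`. -/
def christoffel (e : OpenPartialHomeomorph M (EuclideanSpace ℝ (Fin n)))
    (k i j : Fin n) (y : EuclideanSpace ℝ (Fin n)) : ℝ :=
  (1 / 2 : ℝ) * ∑ l, (metricMatrix e y)⁻¹ k l *
    (partialDeriv i (fun z ↦ metricMatrix e z j l) y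
      + partialDeriv j (fun z ↦ metricMatrix e z i l) y
      - partialDeriv l (fun z ↦ metricMatrix e z i j) y)

/-- The components `(∇df)(∂/∂xⁱ, ∂/∂xʲ) = ∂ᵢ∂ⱼ f - ∑ₖ Γᵏᵢⱼ ∂ₖ f` of the Riemannian Hessian
`∇df` in the chart `e`, at the point with coordinates `y`. -/
def hessian (e : OpenPartialHomeomorph M (EuclideanSpace ℝ (Fin n))) (f : M → ℝ)
    (y : EuclideanSpace ℝ (Fin n)) (i j : Fin n) : ℝ :=
  partialDeriv i (partialDeriv j (f ∘ e.symm)) y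
    - ∑ k, christoffel e k i j y * partialDeriv k (f ∘ e.symm) y

/-- A (`C²`) function on a Riemannian manifold is convex if its Hessian `∇df` is nonnegative
definite at every point. -/
def IsConvex (n : ℕ) [ChartedSpace (EuclideanSpace ℝ (Fin n)) M]
    [RiemannianBundle (fun x : M ↦ TangentSpace (𝓡 n) x)] (f : M → ℝ) : Prop :=
  ∀ e ∈ atlas (EuclideanSpace ℝ (Fin n)) M, ∀ x ∈ e.source, ∀ v : Fin n → ℝ,
    0 ≤ ∑ i, ∑ j, hessian e f (e x) i j * v i * v j

/-- The gradient `∇f`, i.e. the vector dual to `df` under the metric: `⟨∇f, v⟩ = df(v)`. -/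
def riemGrad (n : ℕ) [ChartedSpace (EuclideanSpace ℝ (Fin n)) M]
    [RiemannianBundle (fun x : M ↦ TangentSpace (𝓡 n) x)] (f : M → ℝ) (x : M) :
    TangentSpace (𝓡 n) x :=
  haveI : FiniteDimensional ℝ (TangentSpace (𝓡 n) x) :=
    inferInstanceAs (FiniteDimensional ℝ (EuclideanSpace ℝ (Fin n)))
  haveI : CompleteSpace (TangentSpace (𝓡 n) x) := FiniteDimensional.complete ℝ _
  (InnerProductSpace.toDual ℝ (TangentSpace (𝓡 n) x)).symm (mvfderiv (𝓡 n) f x)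

/-- The pairing `⟨|df|^(p-2) df, dφ⟩` at `x` for the metric on covectors dual to the Riemannian
metric; it equals `|∇f|^(p-2) ⟨∇f, ∇φ⟩`, and it vanishes wherever `df = 0`. -/
def pFlux (n : ℕ) [ChartedSpace (EuclideanSpace ℝ (Fin n)) M]
    [RiemannianBundle (fun x : M ↦ TangentSpace (𝓡 n) x)] (p : ℝ) (f φ : M → ℝ) (x : M) : ℝ :=
  ‖riemGrad n f x‖ ^ (p - 2) * inner ℝ (riemGrad n f x) (riemGrad n φ x)

end Metric

/-- In a second countable manifold, countably many of the preferred chart domains cover. -/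
theorem exists_countable_chart_cover (n : ℕ) (M : Type*) [TopologicalSpace M]
    [SecondCountableTopology M] [ChartedSpace (EuclideanSpace ℝ (Fin n)) M] :
    ∃ s : Set M, s.Countable ∧
      ⋃ c ∈ s, (chartAt (EuclideanSpace ℝ (Fin n)) c).source = Set.univ :=
  TopologicalSpace.countable_cover_nhds
    fun c ↦ chart_source_mem_nhds (EuclideanSpace ℝ (Fin n)) c

/-- A countable set of points whose preferred chart domains cover the manifold. -/
def chartCenters (n : ℕ) (M : Type*) [TopologicalSpace M] [SecondCountableTopology M]
    [ChartedSpace (EuclideanSpace ℝ (Fin n)) M] : Set M :=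
  (exists_countable_chart_cover n M).choose

/-- An enumeration of `chartCenters`. -/
def chartIndex (n : ℕ) (M : Type*) [TopologicalSpace M] [SecondCountableTopology M]
    [ChartedSpace (EuclideanSpace ℝ (Fin n)) M] : chartCenters n M → ℕ :=
  ((exists_countable_chart_cover n M).choose_spec.1.exists_injective_nat).choose

/-- The points in the domain of the chart centred at `c` that are in no chart domain enumerated
before. These sets partition the manifold. -/
def chartPiece (n : ℕ) {M : Type*} [TopologicalSpace M] [SecondCountableTopology M]
    [ChartedSpace (EuclideanSpace ℝ (Fin n)) M] (c : chartCenters n M) : Set M :=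
  (chartAt (EuclideanSpace ℝ (Fin n)) (c : M)).source \
    ⋃ (d : chartCenters n M) (_ : chartIndex n M d < chartIndex n M c),
      (chartAt (EuclideanSpace ℝ (Fin n)) (d : M)).source

section Volume

variable [RiemannianBundle (fun x : M ↦ TangentSpace (𝓡 n) x)] [MeasurableSpace M]

/-- The Riemannian volume `√det(gᵢⱼ) dx¹ ⋯ dxⁿ` of the domain of the chart `e`, as a measure on
the manifold carried by that domain. -/
def chartVolume (e : OpenPartialHomeomorph M (EuclideanSpace ℝ (Fin n))) : Measure M :=
  ((volume.restrict e.target).withDensity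
    fun y ↦ ENNReal.ofReal (Real.sqrt (metricMatrix e y).det)).map e.symm

/-- The Riemannian volume measure `dv`: it is glued from the measures `√det(gᵢⱼ) dx¹ ⋯ dxⁿ` along
a countable partition into pieces of chart domains. -/
def riemannianVolume (n : ℕ) (M : Type*) [TopologicalSpace M] [SecondCountableTopology M]
    [ChartedSpace (EuclideanSpace ℝ (Fin n)) M]
    [RiemannianBundle (fun x : M ↦ TangentSpace (𝓡 n) x)] [MeasurableSpace M] : Measure M :=
  Measure.sum fun c : chartCenters n M ↦
    (chartVolume (chartAt (EuclideanSpace ℝ (Fin n)) (c : M))).restrict (chartPiece n c)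

end Volume

/-- `f` is `p`-subharmonic: `div(|df|^(p-2) df) ≥ 0` weakly, that is, for every nonnegative
`φ ∈ C₀^∞(M)` the integral `∫ ⟨|df|^(p-2) df, dφ⟩ dv` exists and is nonpositive. -/
def IsPSubharmonic (n : ℕ) {M : Type*} [TopologicalSpace M] [SecondCountableTopology M]
    [ChartedSpace (EuclideanSpace ℝ (Fin n)) M]
    [RiemannianBundle (fun x : M ↦ TangentSpace (𝓡 n) x)] [MeasurableSpace M]
    (p : ℝ) (f : M → ℝ) : Prop :=
  ∀ φ : M → ℝ, ContMDiff (𝓡 n) 𝓘(ℝ, ℝ) ∞ φ → HasCompactSupport φ → (∀ x, 0 ≤ φ x) →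
    Integrable (pFlux n p f φ) (riemannianVolume n M) ∧
      ∫ x, pFlux n p f φ x ∂(riemannianVolume n M) ≤ 0

end RiemannianPLaplace

end

/-! Write `X` for the gradient of `f`. Where `X` is nonzero, the divergence of `|X|^(p-2) X` is
`|X|^(p-4) (|X|² Δf + (p-2) ∇df(X,X))`. A nonnegative form satisfies `∇df(X,X) ≤ |X|² Δf`, so the
bracket is at least `(p-1) ∇df(X,X) ≥ 0`, also when `1 < p < 2`.

Critical points are the obstacle: there the flux need not be differentiable. It is therefore
replaced by `(|X|² + ε)^((p-2)/2) X`, which is `C¹`. With `Q = |X|² + ε` in place of `|X|²` the same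
estimate holds, because `|X|² Δf ≤ Q Δf` (`divergence_regFlux_nonneg`). Integration by parts against
a nonnegative test function gives the inequality for each `ε`. As `ε → 0` the integrands are
dominated by a multiple of `(|X|² + 1)^((p-1)/2)`, a bound that uses `p > 1`
(`integral_coordFlux_nonpos`).

All of this takes place in one chart, where the Hessian is explicit in the metric and its first
derivatives. The passage to the manifold rests on two facts: the glued volume agrees on every chart
domain with `√det g dx` (`riemannianVolume_restrict_source`), and the flux is additive in the test
function, so that a smooth partition of unity reduces to test functions supported in a chart. -/

noncomputable section

namespace RiemannianPLaplace

open Matrix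

/-! ### Linear algebra: trace estimates and the pointwise Hessian -/

section LinearAlgebra

variable {n : ℕ}

/-- A nonnegative quadratic form is bounded by its trace. -/
theorem quadratic_le_trace {m : ℕ} {K : Fin m → Fin m → ℝ}
    (hK : ∀ c : Fin m → ℝ, 0 ≤ ∑ a, ∑ b, K a b * c a * c b) (c : Fin m → ℝ) :
    ∑ a, ∑ b, K a b * c a * c b ≤ (∑ a, c a ^ 2) * ∑ a, K a a := by
  -- The form is evaluated at `c b • e_a - c a • e_b`. Summed over all pairs, these inequalities
  -- give twice the claim, without symmetry of `K`.
  have hpair : ∀ a b, 0 ≤ K a a * c b ^ 2 - (K a b + K b a) * c a * c b + K b b * c a ^ 2 := by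
    intro a b
    refine (hK fun i ↦ c b * (if i = a then 1 else 0) - c a * (if i = b then 1 else 0)).trans_eq ?_
    simp only [mul_sub, sub_mul, Finset.sum_sub_distrib, mul_ite, ite_mul, mul_one, mul_zero,
      zero_mul, Finset.sum_ite_eq', Finset.mem_univ, if_true]
    ring
  have hsum := Finset.sum_nonneg fun a (_ : a ∈ Finset.univ) ↦
    Finset.sum_nonneg fun b (_ : b ∈ Finset.univ) ↦ hpair a b
  simp only [Finset.sum_add_distrib, Finset.sum_sub_distrib, add_mul] at hsum
  have h1 : ∑ a, ∑ b, K a a * c b ^ 2 = (∑ a, c a ^ 2) * ∑ a, K a a := by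
    simp only [← Finset.mul_sum, ← Finset.sum_mul, mul_comm]
  have h2 : ∑ a, ∑ b, K b b * c a ^ 2 = (∑ a, c a ^ 2) * ∑ a, K a a := by
    rw [Finset.sum_comm, h1]
  have h3 : ∑ a, ∑ b, K b a * c a * c b = ∑ a, ∑ b, K a b * c a * c b := by
    rw [Finset.sum_comm]
    exact Finset.sum_congr rfl fun i _ ↦ Finset.sum_congr rfl fun j _ ↦ by ring
  rw [h1, h2, h3] at hsum
  linarith

/-- For a nonnegative quadratic form `H`, the trace with respect to a positive semidefinite `P` is
nonnegative, and it controls the value of `H` at the vector `P U`. -/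
theorem quadratic_le_trace_mul {P : Matrix (Fin n) (Fin n) ℝ} (hP : P.PosSemidef)
    {H : Fin n → Fin n → ℝ} (hH : ∀ v : Fin n → ℝ, 0 ≤ ∑ i, ∑ j, H i j * v i * v j)
    (U : Fin n → ℝ) :
    0 ≤ ∑ i, ∑ j, P i j * H i j ∧
    ∑ i, ∑ j, H i j * (P *ᵥ U) i * (P *ᵥ U) j
      ≤ ((P *ᵥ U) ⬝ᵥ U) * ∑ i, ∑ j, P i j * H i j := by
  -- Writing `P = ∑ s_a s_aᵀ` and `K a b = H(s_a, s_b)` turns the `P`-trace of `H` into the plain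
  -- trace of `K`. With `c_a = s_a ⬝ U`, the value of `H` at `P U` is `K(c,c)` and `(P U) ⬝ U =
  -- |c|²`.
  obtain ⟨m, s, hs⟩ := posSemidef_iff_eq_sum_vecMulVec.mp hP
  have hPij : ∀ i j, P i j = ∑ a, s a i * s a j := by
    intro i j
    simp [hs, Matrix.sum_apply, vecMulVec_apply]
  set K : Fin m → Fin m → ℝ := fun a b ↦ ∑ i, ∑ j, H i j * s a i * s b j with hKdef
  have hX : ∀ i, (P *ᵥ U) i = ∑ a, (s a ⬝ᵥ U) * s a i := by
    intro i
    simp only [mulVec, dotProduct, hPij, Finset.sum_mul]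
    rw [Finset.sum_comm]
    exact Finset.sum_congr rfl fun a _ ↦ Finset.sum_congr rfl fun j _ ↦ by ring
  have htr : ∑ i, ∑ j, P i j * H i j = ∑ a, K a a := by
    simp only [hPij, hKdef, Finset.sum_mul]
    rw [Finset.sum_comm_cycle]
    refine Finset.sum_congr rfl fun a _ ↦ ?_
    exact Finset.sum_congr rfl fun i _ ↦ Finset.sum_congr rfl fun j _ ↦ by ring
  have hq : (P *ᵥ U) ⬝ᵥ U = ∑ a, (s a ⬝ᵥ U) ^ 2 := by
    change ∑ i, (P *ᵥ U) i * U i = _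
    simp only [hX, Finset.sum_mul]
    rw [Finset.sum_comm]
    refine Finset.sum_congr rfl fun a _ ↦ ?_
    simp only [mul_assoc, ← Finset.mul_sum]
    exact (sq _).symm
  have hcomb : ∀ c : Fin m → ℝ, ∑ i, ∑ j, H i j * (∑ a, c a * s a i) * (∑ b, c b * s b j)
      = ∑ a, ∑ b, K a b * c a * c b := by
    intro c
    simp only [hKdef, Finset.sum_mul, Finset.mul_sum]
    rw [Finset.sum_comm_cycle]
    conv_rhs => rw [Finset.sum_comm]
    refine Finset.sum_congr rfl fun a _ ↦ ?_
    rw [Finset.sum_comm_cycle]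
    exact Finset.sum_congr rfl fun b _ ↦ Finset.sum_congr rfl fun i _ ↦
      Finset.sum_congr rfl fun j _ ↦ by ring
  have hK : ∀ c : Fin m → ℝ, 0 ≤ ∑ a, ∑ b, K a b * c a * c b := fun c ↦ by
    rw [← hcomb]; exact hH _
  refine ⟨htr ▸ Finset.sum_nonneg fun a _ ↦ hH (s a), ?_⟩
  rw [htr, hq]
  simp only [hX]
  rw [hcomb]
  exact quadratic_le_trace hK _

variable (P : Matrix (Fin n) (Fin n) ℝ) (A : Fin n → Matrix (Fin n) (Fin n) ℝ)
  (B : Fin n → Fin n → ℝ) (U : Fin n → ℝ)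

/-- The Hessian in coordinates: `P` is the inverse metric, `A` the first derivatives of the metric,
`B` the second and `U` the first derivatives of the function. -/
def algHessian (i j : Fin n) : ℝ :=
  B i j - ∑ k, (1 / 2 : ℝ) * (∑ l, P k l * (A i j l + A j i l - A l i j)) * U k

variable {P A}

/-- Symmetry of `P` lets the inverse metric in the Christoffel symbols act on `U`, so that only the
gradient `P U` remains. -/
theorem algHessian_eq (hP : P.IsSymm) (i j : Fin n) :
    algHessian P A B U i j
      = B i j - 1 / 2 * ((A i *ᵥ (P *ᵥ U)) j + (A j *ᵥ (P *ᵥ U)) i - ∑ l, A l i j * (P *ᵥ U) l) := by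
  have hX : ∀ l, ∑ k, P k l * U k = (P *ᵥ U) l := fun l ↦
    Finset.sum_congr rfl fun k _ ↦ by rw [hP.apply]
  have : ∑ k, (1 / 2 : ℝ) * (∑ l, P k l * (A i j l + A j i l - A l i j)) * U k
      = 1 / 2 * ∑ l, (A i j l + A j i l - A l i j) * (P *ᵥ U) l := by
    simp only [← hX, Finset.mul_sum, Finset.sum_mul]
    rw [Finset.sum_comm]
    exact Finset.sum_congr rfl fun a _ ↦ Finset.sum_congr rfl fun j _ ↦ by ring
  rw [algHessian, this]
  simp only [add_mul, sub_mul, Finset.sum_add_distrib, Finset.sum_sub_distrib]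
  rfl

/-- This is the Laplace–Beltrami operator in divergence form: the first sum is `∑ ∂ᵢXⁱ` by
`partialDeriv_coordGrad`, the second is the derivative of `log √det g` along `X` by
`partialDeriv_sqrt_det`. -/
theorem trace_algHessian (hP : P.IsSymm) :
    ∑ i, ∑ j, P i j * algHessian P A B U i j
      = ∑ i, (P *ᵥ (B i - A i *ᵥ (P *ᵥ U))) i
        + 1 / 2 * ∑ l, (∑ i, ∑ j, P i j * A l i j) * (P *ᵥ U) l := by
  simp only [algHessian_eq B U hP]
  have h1 : ∑ i, ∑ j, P i j * (A j *ᵥ (P *ᵥ U)) i = ∑ i, ∑ j, P i j * (A i *ᵥ (P *ᵥ U)) j := by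
    rw [Finset.sum_comm]
    exact Finset.sum_congr rfl fun i _ ↦ Finset.sum_congr rfl fun j _ ↦ by rw [hP.apply]
  have h2 : ∑ l, (∑ i, ∑ j, P i j * A l i j) * (P *ᵥ U) l
      = ∑ i, ∑ j, P i j * ∑ l, A l i j * (P *ᵥ U) l := by
    simp only [Finset.mul_sum, Finset.sum_mul]
    symm
    rw [Finset.sum_comm_cycle]
    exact Finset.sum_congr rfl fun l _ ↦ Finset.sum_congr rfl fun i _ ↦
      Finset.sum_congr rfl fun j _ ↦ by ring
  have h3 : ∑ i, (P *ᵥ (B i - A i *ᵥ (P *ᵥ U))) i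
      = ∑ i, ∑ j, P i j * B i j - ∑ i, ∑ j, P i j * (A i *ᵥ (P *ᵥ U)) j := by
    simp only [← Finset.sum_sub_distrib, ← mul_sub]
    rfl
  rw [h2, h3]
  have : ∀ i j, P i j * (B i j - 1 / 2 * ((A i *ᵥ (P *ᵥ U)) j + (A j *ᵥ (P *ᵥ U)) i
      - ∑ l, A l i j * (P *ᵥ U) l))
      = P i j * B i j - 1 / 2 * (P i j * (A i *ᵥ (P *ᵥ U)) j)
        - 1 / 2 * (P i j * (A j *ᵥ (P *ᵥ U)) i) + 1 / 2 * (P i j * ∑ l, A l i j * (P *ᵥ U) l) := fun i j ↦ by ring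
  simp only [this, Finset.sum_add_distrib, Finset.sum_sub_distrib, ← Finset.mul_sum, h1]
  ring

/-- The right side is half the derivative of `|du|²` along the gradient, as
`partialDeriv_coordPairing_self` shows; this is how the Hessian enters when the weight of the flux
is differentiated. -/
theorem algHessian_gradient (hP : P.IsSymm) :
    ∑ i, ∑ j, algHessian P A B U i j * (P *ᵥ U) i * (P *ᵥ U) j
      = ∑ i, (P *ᵥ U) i * ((P *ᵥ U) ⬝ᵥ B i - 1 / 2 * ((P *ᵥ U) ⬝ᵥ (A i *ᵥ (P *ᵥ U)))) := by
  simp only [algHessian_eq B U hP]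
  set X := P *ᵥ U
  have h1 : ∑ i, ∑ j, (A j *ᵥ X) i * X i * X j = ∑ i, ∑ j, (A i *ᵥ X) j * X i * X j := by
    rw [Finset.sum_comm]
    exact Finset.sum_congr rfl fun i _ ↦ Finset.sum_congr rfl fun j _ ↦ by ring
  have h2 : ∑ i, ∑ j, (∑ l, A l i j * X l) * X i * X j = ∑ i, ∑ j, (A i *ᵥ X) j * X i * X j := by
    simp only [mulVec, dotProduct, Finset.sum_mul]
    rw [Finset.sum_comm_cycle]
    exact Finset.sum_congr rfl fun l _ ↦ Finset.sum_congr rfl fun i _ ↦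
      Finset.sum_congr rfl fun j _ ↦ by ring
  have h3 : ∑ i, X i * (X ⬝ᵥ B i - 1 / 2 * (X ⬝ᵥ (A i *ᵥ X)))
      = ∑ i, ∑ j, B i j * X i * X j - 1 / 2 * ∑ i, ∑ j, (A i *ᵥ X) j * X i * X j := by
    simp only [mul_sub, dotProduct, Finset.mul_sum, ← Finset.sum_sub_distrib]
    exact Finset.sum_congr rfl fun i _ ↦ Finset.sum_congr rfl fun j _ ↦ by ring
  rw [h3]
  have : ∀ i j, (B i j - 1 / 2 * ((A i *ᵥ X) j + (A j *ᵥ X) i - ∑ l, A l i j * X l)) * X i * X j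
      = B i j * X i * X j - 1 / 2 * ((A i *ᵥ X) j * X i * X j) - 1 / 2 * ((A j *ᵥ X) i * X i * X j)
        + 1 / 2 * ((∑ l, A l i j * X l) * X i * X j) := fun i j ↦ by ring
  simp only [this, Finset.sum_add_distrib, Finset.sum_sub_distrib, ← Finset.mul_sum, h1, h2]
  ring

end LinearAlgebra

/-! ### Calculus of determinants, inverse matrices and partial derivatives -/

section Calculus

variable {n : ℕ}

/-- Jacobi's formula for the derivative of the determinant. -/
theorem hasFDerivAt_det {F : Type*} [NormedAddCommGroup F] [NormedSpace ℝ F]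
    {G : F → Matrix (Fin n) (Fin n) ℝ} {G' : Fin n → Fin n → F →L[ℝ] ℝ} {y : F}
    (h : ∀ i j, HasFDerivAt (fun z ↦ G z i j) (G' i j) y) :
    HasFDerivAt (fun z ↦ (G z).det) (∑ i, ∑ j, (G y).adjugate i j • G' j i) y := by
  have h1 : HasFDerivAt (fun z ↦ ∑ σ : Equiv.Perm (Fin n), ((Equiv.Perm.sign σ : ℤ) : ℝ) *
      ∏ i, G z (σ i) i) (∑ σ : Equiv.Perm (Fin n), ((Equiv.Perm.sign σ : ℤ) : ℝ) •
        ∑ i, (∏ j ∈ Finset.univ.erase i, G y (σ j) j) • G' (σ i) i) y :=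
    HasFDerivAt.fun_sum fun σ _ ↦
      (HasFDerivAt.finsetProd fun i _ ↦ h (σ i) i).const_mul _
  simp only [det_apply']
  convert h1 using 1
  ext v
  -- By Cramer's rule the sum is the determinant of `G y` with column `i` replaced by its
  -- derivative; the Leibniz expansion of that determinant gives the terms of the product rule.
  have hcr : ∀ i, ∑ j, (G y).adjugate i j * G' j i v
      = ∑ σ : Equiv.Perm (Fin n), ((Equiv.Perm.sign σ : ℤ) : ℝ) *
        ((∏ j ∈ Finset.univ.erase i, G y (σ j) j) * G' (σ i) i v) := by
    intro i
    have : ∑ j, (G y).adjugate i j * G' j i v = (G y).cramer (fun j ↦ G' j i v) i := by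
      rw [cramer_eq_adjugate_mulVec]; rfl
    rw [this, cramer_apply, det_apply']
    refine Finset.sum_congr rfl fun σ _ ↦ ?_
    rw [← Finset.mul_prod_erase _ _ (Finset.mem_univ i), updateCol_self, mul_comm (G' (σ i) i v)]
    congr 2
    exact Finset.prod_congr rfl fun j hj ↦ by rw [updateCol_ne (Finset.ne_of_mem_erase hj)]
  simp only [_root_.sum_apply, _root_.smul_apply, smul_eq_mul, hcr,
    Finset.mul_sum]
  rw [Finset.sum_comm]

theorem contDiffAt_det {F : Type*} [NormedAddCommGroup F] [NormedSpace ℝ F] {k : WithTop ℕ∞}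
    {G : F → Matrix (Fin n) (Fin n) ℝ} {y : F} (h : ∀ i j, ContDiffAt ℝ k (fun z ↦ G z i j) y) :
    ContDiffAt ℝ k (fun z ↦ (G z).det) y := by
  simp only [det_apply']
  exact ContDiffAt.sum fun σ _ ↦ contDiffAt_const.mul (contDiffAt_prod fun i _ ↦ h _ _)

theorem contDiffAt_inv_apply {F : Type*} [NormedAddCommGroup F] [NormedSpace ℝ F] {k : WithTop ℕ∞}
    {G : F → Matrix (Fin n) (Fin n) ℝ} {y : F} (h : ∀ i j, ContDiffAt ℝ k (fun z ↦ G z i j) y)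
    (hdet : (G y).det ≠ 0) (i j : Fin n) : ContDiffAt ℝ k (fun z ↦ (G z)⁻¹ i j) y := by
  simp only [inv_def, Matrix.smul_apply, Ring.inverse_eq_inv', smul_eq_mul, adjugate_apply]
  refine ((contDiffAt_det h).inv hdet).mul ?_
  refine contDiffAt_det (G := fun z ↦ (G z).updateRow j (Pi.single i 1)) fun a b ↦ ?_
  by_cases hab : a = j
  · subst hab; simpa only [updateRow_self] using contDiffAt_const
  · simpa only [updateRow_ne hab] using h a b

variable {u v : EuclideanSpace ℝ (Fin n) → ℝ} {y : EuclideanSpace ℝ (Fin n)} (i : Fin n)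

theorem partialDeriv_mul (hu : DifferentiableAt ℝ u y) (hv : DifferentiableAt ℝ v y) :
    partialDeriv i (fun z ↦ u z * v z) y = u y * partialDeriv i v y + partialDeriv i u y * v y := by
  simp [partialDeriv, fderiv_fun_mul hu hv, mul_comm]

theorem partialDeriv_sum {ι : Type*} (s : Finset ι) {w : ι → EuclideanSpace ℝ (Fin n) → ℝ}
    (h : ∀ a ∈ s, DifferentiableAt ℝ (w a) y) :
    partialDeriv i (fun z ↦ ∑ a ∈ s, w a z) y = ∑ a ∈ s, partialDeriv i (w a) y := by
  simp [partialDeriv, fderiv_fun_sum h]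

theorem partialDeriv_congr (h : u =ᶠ[nhds y] v) : partialDeriv i u y = partialDeriv i v y := by
  rw [partialDeriv, h.fderiv_eq, partialDeriv]

theorem contDiffAt_partialDeriv {k l : WithTop ℕ∞} (hu : ContDiffAt ℝ l u y) (hkl : k + 1 ≤ l) :
    ContDiffAt ℝ k (partialDeriv i u) y :=
  (hu.fderiv_right hkl).clm_apply contDiffAt_const

theorem partialDeriv_rpow {r : ℝ} (hu : DifferentiableAt ℝ u y) (h : u y ≠ 0) :
    partialDeriv i (fun z ↦ u z ^ r) y = r * u y ^ (r - 1) * partialDeriv i u y := by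
  simp [partialDeriv, (hu.hasFDerivAt.rpow_const (p := r) (Or.inl h)).fderiv]

theorem partialDeriv_sqrt (hu : DifferentiableAt ℝ u y) (h : u y ≠ 0) :
    partialDeriv i (fun z ↦ √(u z)) y = 1 / (2 * √(u y)) * partialDeriv i u y := by
  simp [partialDeriv, (hu.hasFDerivAt.sqrt h).fderiv]

/-- The derivative of the volume density. -/
theorem partialDeriv_sqrt_det {G : EuclideanSpace ℝ (Fin n) → Matrix (Fin n) (Fin n) ℝ}
    (hG : ∀ a b, DifferentiableAt ℝ (fun z ↦ G z a b) y) (hpos : 0 < (G y).det)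
    (hsymm : ∀ᶠ z in nhds y, (G z).IsSymm) :
    partialDeriv i (fun z ↦ √(G z).det) y
      = √(G y).det * (1 / 2 * ∑ a, ∑ b, (G y)⁻¹ a b * partialDeriv i (fun z ↦ G z a b) y) := by
  have hd := hasFDerivAt_det fun a b ↦ (hG a b).hasFDerivAt
  have hs : ∀ a b, partialDeriv i (fun z ↦ G z b a) y = partialDeriv i (fun z ↦ G z a b) y :=
    fun a b ↦ partialDeriv_congr i (hsymm.mono fun z hz ↦ hz.apply a b)
  have hsum : partialDeriv i (fun z ↦ (G z).det) y
      = (G y).det * ∑ a, ∑ b, (G y)⁻¹ a b * partialDeriv i (fun z ↦ G z a b) y := by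
    rw [partialDeriv, hd.fderiv]
    simp only [_root_.sum_apply, _root_.smul_apply, smul_eq_mul,
      Finset.mul_sum]
    refine Finset.sum_congr rfl fun a _ ↦ Finset.sum_congr rfl fun b _ ↦ ?_
    rw [← hs a b, inv_def, Matrix.smul_apply, Ring.inverse_eq_inv', smul_eq_mul]
    simp only [partialDeriv]
    field_simp
  rw [partialDeriv_sqrt i hd.differentiableAt hpos.ne', hsum]
  have h1 := Real.sq_sqrt hpos.le
  have h2 := Real.sqrt_pos.2 hpos
  generalize √(G y).det = s at h1 h2 ⊢
  rw [← h1]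
  field_simp

end Calculus

/-! ### Divergence of the regularized flux in coordinates -/

section Divergence

variable {n : ℕ}

/-- The gradient of `u` in coordinates, for the metric `G`. -/
def coordGrad (G : EuclideanSpace ℝ (Fin n) → Matrix (Fin n) (Fin n) ℝ)
    (u : EuclideanSpace ℝ (Fin n) → ℝ) (y : EuclideanSpace ℝ (Fin n)) : Fin n → ℝ :=
  (G y)⁻¹ *ᵥ fun j ↦ partialDeriv j u y

/-- The pairing of the differentials of `u` and `v` in coordinates, for the metric `G`. -/
def coordPairing (G : EuclideanSpace ℝ (Fin n) → Matrix (Fin n) (Fin n) ℝ)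
    (u v : EuclideanSpace ℝ (Fin n) → ℝ) (y : EuclideanSpace ℝ (Fin n)) : ℝ :=
  coordGrad G u y ⬝ᵥ fun j ↦ partialDeriv j v y

/-- The Hessian of `u` in coordinates, for the metric `G`. -/
def coordHessian (G : EuclideanSpace ℝ (Fin n) → Matrix (Fin n) (Fin n) ℝ)
    (u : EuclideanSpace ℝ (Fin n) → ℝ) (y : EuclideanSpace ℝ (Fin n)) : Fin n → Fin n → ℝ :=
  algHessian (G y)⁻¹ (fun i ↦ Matrix.of fun a b ↦ partialDeriv i (fun z ↦ G z a b) y)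
    (fun i j ↦ partialDeriv i (partialDeriv j u) y) fun j ↦ partialDeriv j u y

/-- The regularized flux `√det G (|du|² + ε)^((p-2)/2) ∇u` in coordinates. -/
def regFlux (G : EuclideanSpace ℝ (Fin n) → Matrix (Fin n) (Fin n) ℝ)
    (u : EuclideanSpace ℝ (Fin n) → ℝ) (p ε : ℝ) (i : Fin n) (y : EuclideanSpace ℝ (Fin n)) : ℝ :=
  √(G y).det * ((coordPairing G u u y + ε) ^ ((p - 2) / 2) * coordGrad G u y i)

variable {G : EuclideanSpace ℝ (Fin n) → Matrix (Fin n) (Fin n) ℝ}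
  {u : EuclideanSpace ℝ (Fin n) → ℝ} {y : EuclideanSpace ℝ (Fin n)}

theorem contDiffAt_coordGrad {k l : WithTop ℕ∞} (hG : ∀ a b, ContDiffAt ℝ k (fun z ↦ G z a b) y)
    (hdet : (G y).det ≠ 0) (hu : ContDiffAt ℝ l u y) (hkl : k + 1 ≤ l) (i : Fin n) :
    ContDiffAt ℝ k (fun z ↦ coordGrad G u z i) y := by
  unfold coordGrad mulVec dotProduct
  exact ContDiffAt.sum fun j _ ↦
    (contDiffAt_inv_apply hG hdet i j).mul (contDiffAt_partialDeriv j hu hkl)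

theorem contDiffAt_coordPairing {k l : WithTop ℕ∞} {v : EuclideanSpace ℝ (Fin n) → ℝ}
    (hG : ∀ a b, ContDiffAt ℝ k (fun z ↦ G z a b) y)
    (hdet : (G y).det ≠ 0) (hu : ContDiffAt ℝ l u y) (hv : ContDiffAt ℝ l v y) (hkl : k + 1 ≤ l) :
    ContDiffAt ℝ k (coordPairing G u v) y := by
  unfold coordPairing dotProduct
  exact ContDiffAt.sum fun j _ ↦
    (contDiffAt_coordGrad hG hdet hu hkl j).mul (contDiffAt_partialDeriv j hv hkl)

theorem coordPairing_self_nonneg (hpos : (G y).PosDef) : 0 ≤ coordPairing G u u y := by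
  have := hpos.inv.posSemidef.dotProduct_mulVec_nonneg fun j ↦ partialDeriv j u y
  rw [coordPairing, coordGrad, dotProduct_comm]
  simpa using this

theorem contDiffAt_regFlux {p ε : ℝ} (hε : 0 < ε)
    (hG : ∀ a b, ContDiffAt ℝ 1 (fun z ↦ G z a b) y) (hpos : (G y).PosDef)
    (hu : ContDiffAt ℝ 2 u y) (i : Fin n) : ContDiffAt ℝ 1 (regFlux G u p ε i) y := by
  have hdet := hpos.det_pos.ne'
  refine ((contDiffAt_det hG).sqrt hdet).mul (ContDiffAt.mul ?_
    (contDiffAt_coordGrad hG hdet hu (by norm_num) i))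
  refine ((contDiffAt_coordPairing hG hdet hu hu (by norm_num)).add
    contDiffAt_const).rpow_const_of_ne ?_
  have := coordPairing_self_nonneg (u := u) hpos
  positivity

/-- Differentiating the identity `G X = du` and solving for `∂ᵢX` avoids a formula for the
derivative of the inverse matrix. -/
theorem partialDeriv_coordGrad (hG : ∀ a b, ContDiffAt ℝ 1 (fun z ↦ G z a b) y)
    (hpos : ∀ᶠ z in nhds y, (G z).PosDef) (hu : ContDiffAt ℝ 2 u y) (i : Fin n) :
    (fun j ↦ partialDeriv i (fun z ↦ coordGrad G u z j) y)
      = (G y)⁻¹ *ᵥ ((fun j ↦ partialDeriv i (partialDeriv j u) y)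
        - (Matrix.of fun a b ↦ partialDeriv i (fun z ↦ G z a b) y) *ᵥ coordGrad G u y) := by
  have hy := hpos.self_of_nhds
  have hX : ∀ j, DifferentiableAt ℝ (fun z ↦ coordGrad G u z j) y := fun j ↦
    (contDiffAt_coordGrad hG hy.det_pos.ne' hu (by norm_num) j).differentiableAt one_ne_zero
  have hGd : ∀ a b, DifferentiableAt ℝ (fun z ↦ G z a b) y := fun a b ↦
    (hG a b).differentiableAt one_ne_zero
  have key : ∀ a, partialDeriv i (partialDeriv a u) y
      = ∑ b, (G y a b * partialDeriv i (fun z ↦ coordGrad G u z b) y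
        + partialDeriv i (fun z ↦ G z a b) y * coordGrad G u y b) := by
    intro a
    have heq : partialDeriv a u =ᶠ[nhds y] fun z ↦ ∑ b, G z a b * coordGrad G u z b := by
      filter_upwards [hpos] with z hz
      have : G z *ᵥ coordGrad G u z = fun j ↦ partialDeriv j u z := by
        rw [coordGrad, mulVec_mulVec, mul_nonsing_inv _ hz.det_pos.ne'.isUnit, one_mulVec]
      exact (congrFun this a).symm
    rw [partialDeriv_congr i heq, partialDeriv_sum i _ fun b _ ↦ (hGd a b).fun_mul (hX b)]
    exact Finset.sum_congr rfl fun b _ ↦ partialDeriv_mul i (hGd a b) (hX b)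
  have : (fun j ↦ partialDeriv i (partialDeriv j u) y)
        - (Matrix.of fun a b ↦ partialDeriv i (fun z ↦ G z a b) y) *ᵥ coordGrad G u y
      = G y *ᵥ fun j ↦ partialDeriv i (fun z ↦ coordGrad G u z j) y := by
    ext a
    simp only [Pi.sub_apply, key, Finset.sum_add_distrib, mulVec, dotProduct, of_apply]
    ring
  rw [this, mulVec_mulVec, nonsing_inv_mul _ hy.det_pos.ne'.isUnit, one_mulVec]

/-- The product rule is applied to `X ⬝ du`; symmetry of the inverse metric moves it from `∂ᵢX` onto
`du`, which becomes `X` again. -/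
theorem partialDeriv_coordPairing_self (hG : ∀ a b, ContDiffAt ℝ 1 (fun z ↦ G z a b) y)
    (hpos : ∀ᶠ z in nhds y, (G z).PosDef) (hu : ContDiffAt ℝ 2 u y) (i : Fin n) :
    partialDeriv i (coordPairing G u u) y
      = 2 * (coordGrad G u y ⬝ᵥ (fun j ↦ partialDeriv i (partialDeriv j u) y)
        - 1 / 2 * (coordGrad G u y ⬝ᵥ
          ((Matrix.of fun a b ↦ partialDeriv i (fun z ↦ G z a b) y) *ᵥ coordGrad G u y))) := by
  have hy := hpos.self_of_nhds
  have hX : ∀ j, DifferentiableAt ℝ (fun z ↦ coordGrad G u z j) y := fun j ↦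
    (contDiffAt_coordGrad hG hy.det_pos.ne' hu (by norm_num) j).differentiableAt one_ne_zero
  have hU : ∀ j, DifferentiableAt ℝ (partialDeriv j u) y := fun j ↦
    (contDiffAt_partialDeriv j hu (k := 1) (by norm_num)).differentiableAt one_ne_zero
  have h1 : partialDeriv i (coordPairing G u u) y
      = coordGrad G u y ⬝ᵥ (fun j ↦ partialDeriv i (partialDeriv j u) y)
        + (fun j ↦ partialDeriv i (fun z ↦ coordGrad G u z j) y) ⬝ᵥ
          fun j ↦ partialDeriv j u y := by
    refine (partialDeriv_sum i Finset.univ fun b _ ↦ (hX b).fun_mul (hU b)).trans ?_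
    rw [dotProduct, dotProduct, ← Finset.sum_add_distrib]
    exact Finset.sum_congr rfl fun b _ ↦ partialDeriv_mul i (hX b) (hU b)
  have hsymm : (G y)⁻¹ᵀ = (G y)⁻¹ := by simpa using hy.inv.isHermitian.eq
  rw [h1, partialDeriv_coordGrad hG hpos hu i, dotProduct_comm ((G y)⁻¹ *ᵥ _), dotProduct_mulVec,
    ← mulVec_transpose, hsymm]
  change _ + coordGrad G u y ⬝ᵥ _ = _
  rw [dotProduct_sub]
  ring

/-- The divergence of the regularized flux of a convex function is nonnegative. -/
theorem divergence_regFlux_nonneg {p ε : ℝ} (hp : 1 < p) (hε : 0 < ε)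
    (hG : ∀ a b, ContDiffAt ℝ 1 (fun z ↦ G z a b) y) (hpos : ∀ᶠ z in nhds y, (G z).PosDef)
    (hu : ContDiffAt ℝ 2 u y)
    (hH : ∀ v : Fin n → ℝ, 0 ≤ ∑ i, ∑ j, coordHessian G u y i j * v i * v j) :
    0 ≤ ∑ i, partialDeriv i (regFlux G u p ε i) y := by
  have hy := hpos.self_of_nhds
  have hdet := hy.det_pos
  have hq : 0 ≤ coordPairing G u u y := coordPairing_self_nonneg hy
  have hqε : 0 < coordPairing G u u y + ε := by positivity
  have hsymm : (G y)⁻¹.IsSymm := isHermitian_iff_isSymm.1 hy.inv.isHermitian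
  have hX : ∀ j, DifferentiableAt ℝ (fun z ↦ coordGrad G u z j) y := fun j ↦
    (contDiffAt_coordGrad hG hdet.ne' hu (by norm_num) j).differentiableAt one_ne_zero
  have hGd : ∀ a b, DifferentiableAt ℝ (fun z ↦ G z a b) y := fun a b ↦
    (hG a b).differentiableAt one_ne_zero
  have hqd : DifferentiableAt ℝ (fun z ↦ coordPairing G u u z + ε) y :=
    ((contDiffAt_coordPairing hG hdet.ne' hu hu (k := 1)
      (by norm_num)).differentiableAt one_ne_zero).add_const ε
  have hqd' : ∀ i, partialDeriv i (fun z ↦ coordPairing G u u z + ε) y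
      = partialDeriv i (coordPairing G u u) y := fun i ↦ by simp [partialDeriv]
  have hwd : DifferentiableAt ℝ (fun z ↦ (coordPairing G u u z + ε) ^ ((p - 2) / 2)) y :=
    (hqd.hasFDerivAt.rpow_const (Or.inl hqε.ne')).differentiableAt
  have hsd : DifferentiableAt ℝ (fun z ↦ √(G z).det) y :=
    ((contDiffAt_det hG).sqrt hdet.ne').differentiableAt one_ne_zero
  set s := √(G y).det
  set Q := coordPairing G u u y + ε
  set X := coordGrad G u y with hXdef
  set tr := ∑ i, ∑ j, (G y)⁻¹ i j * coordHessian G u y i j with htr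
  set quad := ∑ i, ∑ j, coordHessian G u y i j * X i * X j with hquad
  have hdiv : ∑ i, partialDeriv i (regFlux G u p ε i) y
      = s * (Q ^ ((p - 2) / 2 - 1) * (Q * tr + (p - 2) * quad)) := by
    have hterm : ∀ i, partialDeriv i (regFlux G u p ε i) y
        = s * (Q ^ ((p - 2) / 2) * (1 / 2 * ((∑ a, ∑ b, (G y)⁻¹ a b *
            partialDeriv i (fun z ↦ G z a b) y) * X i)
          + partialDeriv i (fun z ↦ coordGrad G u z i) y)
          + Q ^ ((p - 2) / 2 - 1) * (p - 2) * (X i * (X ⬝ᵥ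
            (fun j ↦ partialDeriv i (partialDeriv j u) y) - 1 / 2 * (X ⬝ᵥ
          ((Matrix.of fun a b ↦ partialDeriv i (fun z ↦ G z a b) y) *ᵥ X))))) := by
      intro i
      unfold regFlux
      rw [partialDeriv_mul i hsd (hwd.fun_mul (hX i)), partialDeriv_mul i hwd (hX i),
        partialDeriv_rpow i hqd hqε.ne', hqd', partialDeriv_coordPairing_self hG hpos hu,
        partialDeriv_sqrt_det i hGd hdet
          (hpos.mono fun z hz ↦ isHermitian_iff_isSymm.1 hz.isHermitian)]
      ring
    have htrace := trace_algHessian (P := (G y)⁻¹)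
      (A := fun i ↦ Matrix.of fun a b ↦ partialDeriv i (fun z ↦ G z a b) y)
      (fun i j ↦ partialDeriv i (partialDeriv j u) y) (fun j ↦ partialDeriv j u y) hsymm
    have hgrad := algHessian_gradient (P := (G y)⁻¹)
      (A := fun i ↦ Matrix.of fun a b ↦ partialDeriv i (fun z ↦ G z a b) y)
      (fun i j ↦ partialDeriv i (partialDeriv j u) y) (fun j ↦ partialDeriv j u y) hsymm
    have hXi : ∀ i, partialDeriv i (fun z ↦ coordGrad G u z i) y = _ := fun i ↦
      congrFun (partialDeriv_coordGrad hG hpos hu i) i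
    simp only [hterm, ← Finset.mul_sum, Finset.sum_add_distrib, hXi]
    change tr = _ at htrace
    change quad = _ at hgrad
    change _ = ∑ i, ((G y)⁻¹ *ᵥ ((fun j ↦ partialDeriv i (partialDeriv j u) y)
        - (Matrix.of fun a b ↦ partialDeriv i (fun z ↦ G z a b) y) *ᵥ X)) i
        + 1 / 2 * ∑ i, (∑ a, ∑ b, (G y)⁻¹ a b * partialDeriv i (fun z ↦ G z a b) y) * X i
      at htrace
    change _ = ∑ i, X i * (X ⬝ᵥ
            (fun j ↦ partialDeriv i (partialDeriv j u) y) - 1 / 2 * (X ⬝ᵥ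
          ((Matrix.of fun a b ↦ partialDeriv i (fun z ↦ G z a b) y) *ᵥ X))) at hgrad
    -- The derivative of the power has exponent lower by one; extracting this common power leaves
    -- the bracket `Q tr + (p - 2) quad`.
    have hpow : Q ^ ((p - 2) / 2) = Q ^ ((p - 2) / 2 - 1) * Q := by
      rw [← Real.rpow_add_one hqε.ne']; congr 1; ring
    rw [← hgrad, add_comm (1 / 2 * _), ← htrace, hpow]
    ring
  obtain ⟨h0, h1⟩ := quadratic_le_trace_mul hy.inv.posSemidef hH fun j ↦ partialDeriv j u y
  change 0 ≤ tr at h0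
  change quad ≤ coordPairing G u u y * tr at h1
  have hquad0 : 0 ≤ quad := hH X
  rw [hdiv]
  refine mul_nonneg (Real.sqrt_nonneg _) (mul_nonneg (Real.rpow_nonneg hqε.le _) ?_)
  have : quad ≤ Q * tr := h1.trans (mul_le_mul_of_nonneg_right (by simp only [Q]; linarith) h0)
  -- `Q tr + (p - 2) quad ≥ quad + (p - 2) quad = (p - 1) quad ≥ 0`.
  nlinarith [mul_nonneg (sub_nonneg.2 hp.le) hquad0]

end Divergence

/-! ### Integration by parts and removal of the regularization -/

section Integration

open Filter Topology

variable {n : ℕ} {Ω : Set (EuclideanSpace ℝ (Fin n))}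
  {ψ : EuclideanSpace ℝ (Fin n) → ℝ}

theorem integrable_of_continuousOn_of_compact (hΩ : IsOpen Ω) (hψ : HasCompactSupport ψ)
    (hψΩ : tsupport ψ ⊆ Ω) {h : EuclideanSpace ℝ (Fin n) → ℝ} (hh : ContinuousOn h Ω)
    (h0 : ∀ y ∉ tsupport ψ, h y = 0) : Integrable h := by
  have hsub : tsupport h ⊆ tsupport ψ :=
    closure_minimal (fun y hy ↦ by_contra fun hn ↦ hy (h0 y hn)) (isClosed_tsupport ψ)
  exact (hh.continuous_of_tsupport_subset hΩ (hsub.trans hψΩ)).integrable_of_hasCompactSupport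
    (hψ.of_isClosed_subset (isClosed_tsupport h) hsub)

theorem partialDeriv_eq_zero_of_notMem_tsupport {y : EuclideanSpace ℝ (Fin n)}
    (hy : y ∉ tsupport ψ) (i : Fin n) : partialDeriv i ψ y = 0 := by
  rw [partialDeriv, image_eq_zero_of_notMem_tsupport (f := fderiv ℝ ψ)
    fun h ↦ hy (tsupport_fderiv_subset ℝ h), _root_.zero_apply]

/-- A vector field with nonnegative divergence pairs nonpositively with the gradient of a
nonnegative test function. -/
theorem integral_mul_partialDeriv_nonpos (hΩ : IsOpen Ω)
    {V : Fin n → EuclideanSpace ℝ (Fin n) → ℝ} (hV : ∀ i, ContDiffOn ℝ 1 (V i) Ω)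
    (hdiv : ∀ y ∈ Ω, 0 ≤ ∑ i, partialDeriv i (V i) y)
    (hψ : ContDiff ℝ 1 ψ) (hψc : HasCompactSupport ψ) (hψΩ : tsupport ψ ⊆ Ω) (hψ0 : ∀ y, 0 ≤ ψ y) :
    Integrable (fun y ↦ ∑ i, V i y * partialDeriv i ψ y) ∧
      ∫ y, ∑ i, V i y * partialDeriv i ψ y ≤ 0 := by
  have hdV : ∀ i, ContinuousOn (partialDeriv i (V i)) Ω := fun i y hy ↦
    (contDiffAt_partialDeriv (k := 0) i ((hV i).contDiffAt (hΩ.mem_nhds hy))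
      (by norm_num)).continuousAt.continuousWithinAt
  have hdψ : ∀ i, Continuous (partialDeriv i ψ) := fun i ↦
    (hψ.continuous_fderiv one_ne_zero).clm_apply continuous_const
  have h1 : ∀ i, Integrable fun y ↦ partialDeriv i ψ y * V i y := fun i ↦
    integrable_of_continuousOn_of_compact hΩ hψc hψΩ ((hdψ i).continuousOn.mul (hV i).continuousOn)
      fun y hy ↦ by simp [partialDeriv_eq_zero_of_notMem_tsupport hy]
  have h2 : ∀ i, Integrable fun y ↦ ψ y * partialDeriv i (V i) y := fun i ↦
    integrable_of_continuousOn_of_compact hΩ hψc hψΩ (hψ.continuous.continuousOn.mul (hdV i))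
      fun y hy ↦ by simp [image_eq_zero_of_notMem_tsupport hy]
  have h3 : ∀ i, Integrable fun y ↦ ψ y * V i y := fun i ↦
    integrable_of_continuousOn_of_compact hΩ hψc hψΩ
      (hψ.continuous.continuousOn.mul (hV i).continuousOn)
      fun y hy ↦ by simp [image_eq_zero_of_notMem_tsupport hy]
  -- Nothing is known of `V` outside `Ω`; integration by parts needs its differentiability only on
  -- the support of `ψ`.
  have hparts : ∀ i, ∫ y, ψ y * partialDeriv i (V i) y = -∫ y, partialDeriv i ψ y * V i y := fun i ↦
    integral_mul_fderiv_eq_neg_fderiv_mul_of_integrable (h1 i) (h2 i) (h3 i)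
      (fun y _ ↦ hψ.differentiable one_ne_zero y)
      fun y hy ↦ ((hV i).contDiffAt (hΩ.mem_nhds (hψΩ hy))).differentiableAt one_ne_zero
  have h1' : ∀ i, Integrable fun y ↦ V i y * partialDeriv i ψ y := fun i ↦ by
    simpa only [mul_comm] using h1 i
  refine ⟨integrable_finsetSum _ fun i _ ↦ h1' i, ?_⟩
  have hpos : 0 ≤ ∫ y, ∑ i, ψ y * partialDeriv i (V i) y := by
    refine integral_nonneg fun y ↦ ?_
    by_cases hy : y ∈ tsupport ψ
    · change 0 ≤ ∑ i, ψ y * partialDeriv i (V i) y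
      rw [← Finset.mul_sum]
      exact mul_nonneg (hψ0 y) (hdiv y (hψΩ hy))
    · simp [image_eq_zero_of_notMem_tsupport hy]
  rw [integral_finsetSum _ fun i _ ↦ h2 i] at hpos
  rw [integral_finsetSum _ fun i _ ↦ h1' i]
  simp only [hparts, Finset.sum_neg_distrib] at hpos
  simp only [mul_comm (V _ _)]
  linarith

variable {G : EuclideanSpace ℝ (Fin n) → Matrix (Fin n) (Fin n) ℝ}
  {u : EuclideanSpace ℝ (Fin n) → ℝ}

/-- Cauchy–Schwarz for the dual metric. It serves twice: it bounds the regularized integrand, and it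
makes the pairing vanish where `du = 0`. -/
theorem coordPairing_sq_le {v : EuclideanSpace ℝ (Fin n) → ℝ} {y : EuclideanSpace ℝ (Fin n)}
    (hpos : (G y).PosDef) :
    coordPairing G u v y ^ 2 ≤ coordPairing G u u y * coordPairing G v v y := by
  obtain ⟨m, s, hs⟩ := posSemidef_iff_eq_sum_vecMulVec.mp hpos.inv.posSemidef
  have h : ∀ a b : EuclideanSpace ℝ (Fin n) → ℝ, coordPairing G a b y
      = ∑ k, (s k ⬝ᵥ fun j ↦ partialDeriv j a y) * (s k ⬝ᵥ fun j ↦ partialDeriv j b y) := by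
    intro a b
    simp [coordPairing, coordGrad, hs, sum_mulVec, sum_dotProduct, vecMulVec_mulVec]
  simp only [h, ← sq]
  exact Finset.sum_mul_sq_le_sq_mul_sq _ _ _

/-- For `p < 2` the weight alone blows up as `q + ε → 0`. The factor `√q ≤ (q + ε)^(1/2)` raises the
exponent to `(p - 1) / 2 > 0`, which makes the bound uniform in `ε`. -/
theorem rpow_mul_sqrt_le {p q ε : ℝ} (hp : 1 < p) (hq : 0 ≤ q) (hε : 0 < ε) (hε1 : ε ≤ 1) :
    (q + ε) ^ ((p - 2) / 2) * √q ≤ (q + 1) ^ ((p - 1) / 2) := by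
  have hqε : 0 < q + ε := by positivity
  calc (q + ε) ^ ((p - 2) / 2) * √q ≤ (q + ε) ^ ((p - 2) / 2) * (q + ε) ^ (1 / 2 : ℝ) := by
        rw [← Real.sqrt_eq_rpow]
        gcongr
        linarith
    _ = (q + ε) ^ ((p - 1) / 2) := by rw [← Real.rpow_add hqε]; congr 1; ring
    _ ≤ (q + 1) ^ ((p - 1) / 2) := by gcongr

/-- Away from `q = 0` the power is continuous. At `q = 0` its limit may fail to exist, but the
factor `r` vanishes and both sides are zero whatever value `0 ^ (p - 2)` takes. -/
theorem tendsto_regularized {p q r : ℝ} (hq : 0 ≤ q) (hr : q = 0 → r = 0) :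
    Tendsto (fun k : ℕ ↦ (q + 1 / ((k : ℝ) + 1)) ^ ((p - 2) / 2) * r) atTop
      (𝓝 (√q ^ (p - 2) * r)) := by
  rcases hq.eq_or_lt with h | h
  · simp [hr h.symm]
  · have hlim : Tendsto (fun k : ℕ ↦ q + 1 / ((k : ℝ) + 1)) atTop (𝓝 q) := by
      simpa using tendsto_one_div_add_atTop_nhds_zero_nat.const_add q
    have : √q ^ (p - 2) = q ^ ((p - 2) / 2) := by
      rw [Real.sqrt_eq_rpow, ← Real.rpow_mul hq]; congr 1; ring
    rw [this]
    exact (hlim.rpow_const (Or.inl h.ne')).mul_const r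

/-- Convex functions are `p`-subharmonic, in coordinates. -/
theorem integral_coordFlux_nonpos {p : ℝ} (hp : 1 < p) (hΩ : IsOpen Ω)
    (hG : ∀ a b, ContDiffOn ℝ 1 (fun z ↦ G z a b) Ω) (hpos : ∀ y ∈ Ω, (G y).PosDef)
    (hu : ContDiffOn ℝ 2 u Ω)
    (hH : ∀ y ∈ Ω, ∀ v : Fin n → ℝ, 0 ≤ ∑ i, ∑ j, coordHessian G u y i j * v i * v j)
    (hψ : ContDiff ℝ 1 ψ) (hψc : HasCompactSupport ψ) (hψΩ : tsupport ψ ⊆ Ω) (hψ0 : ∀ y, 0 ≤ ψ y) :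
    Integrable (fun y ↦ √(G y).det * (√(coordPairing G u u y) ^ (p - 2) * coordPairing G u ψ y)) ∧
      ∫ y, √(G y).det * (√(coordPairing G u u y) ^ (p - 2) * coordPairing G u ψ y) ≤ 0 := by
  have hGat : ∀ y ∈ Ω, ∀ a b, ContDiffAt ℝ 1 (fun z ↦ G z a b) y := fun y hy a b ↦
    (hG a b).contDiffAt (hΩ.mem_nhds hy)
  have huat : ∀ y ∈ Ω, ContDiffAt ℝ 2 u y := fun y hy ↦ hu.contDiffAt (hΩ.mem_nhds hy)
  have hr0 : ∀ v : EuclideanSpace ℝ (Fin n) → ℝ, ∀ y ∉ tsupport ψ, coordPairing G v ψ y = 0 :=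
    fun v y hy ↦ by
      simp [coordPairing, dotProduct, partialDeriv_eq_zero_of_notMem_tsupport hy]
  set F : ℕ → EuclideanSpace ℝ (Fin n) → ℝ := fun k y ↦
    √(G y).det * ((coordPairing G u u y + 1 / ((k : ℝ) + 1)) ^ ((p - 2) / 2)
      * coordPairing G u ψ y) with hF
  have hFsum : ∀ k, F k = fun y ↦
      ∑ i, regFlux G u p (1 / ((k : ℝ) + 1)) i y * partialDeriv i ψ y := by
    intro k
    ext y
    simp only [hF, regFlux, coordPairing, dotProduct, Finset.mul_sum, mul_assoc]
  have hFk : ∀ k, Integrable (F k) ∧ ∫ y, F k y ≤ 0 := by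
    intro k
    have hk : (0 : ℝ) < 1 / ((k : ℝ) + 1) := Nat.one_div_pos_of_nat
    rw [hFsum]
    refine integral_mul_partialDeriv_nonpos hΩ (fun i y hy ↦
      (contDiffAt_regFlux hk (hGat y hy) (hpos y hy) (huat y hy) i).contDiffWithinAt)
      (fun y hy ↦ divergence_regFlux_nonneg hp hk (hGat y hy) ?_ (huat y hy) (hH y hy))
      hψ hψc hψΩ hψ0
    filter_upwards [hΩ.mem_nhds hy] with z hz using hpos z hz
  set bound : EuclideanSpace ℝ (Fin n) → ℝ := fun y ↦
    √(G y).det * ((coordPairing G u u y + 1) ^ ((p - 1) / 2) * √(coordPairing G ψ ψ y)) with hbd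
  have hbound : Integrable bound := by
    refine integrable_of_continuousOn_of_compact hΩ hψc hψΩ (fun y hy ↦ ?_) fun y hy ↦ by
      simp [hbd, hr0 ψ y hy]
    have hdet := (hpos y hy).det_pos.ne'
    have hGy := fun a b ↦ (hGat y hy a b).of_le (zero_le_one (α := WithTop ℕ∞))
    have c1 := (contDiffAt_det hGy).continuousAt
    have c2 := (contDiffAt_coordPairing hGy hdet ((huat y hy).of_le one_le_two)
      ((huat y hy).of_le one_le_two) (by norm_num)).continuousAt
    have c3 := (contDiffAt_coordPairing hGy hdet hψ.contDiffAt hψ.contDiffAt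
      (by norm_num)).continuousAt
    have hq := coordPairing_self_nonneg (u := u) (hpos y hy)
    exact (c1.sqrt.mul (((c2.add continuousAt_const).rpow_const
      (Or.inl (add_pos_of_nonneg_of_pos hq one_pos).ne')).mul c3.sqrt)).continuousWithinAt
  have hle : ∀ k, ∀ᵐ y, ‖F k y‖ ≤ bound y := by
    refine fun k ↦ Eventually.of_forall fun y ↦ ?_
    by_cases hy : y ∈ tsupport ψ
    · have hP := hpos y (hψΩ hy)
      have hq := coordPairing_self_nonneg (u := u) hP
      have hr := Real.abs_le_sqrt (coordPairing_sq_le (u := u) (v := ψ) hP)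
      rw [Real.sqrt_mul hq] at hr
      have hk : (0 : ℝ) < 1 / ((k : ℝ) + 1) := Nat.one_div_pos_of_nat
      have hk1 : 1 / ((k : ℝ) + 1) ≤ 1 := by
        rw [div_le_one (by positivity)]; linarith [(Nat.cast_nonneg k : (0 : ℝ) ≤ k)]
      have hw : 0 ≤ (coordPairing G u u y + 1 / ((k : ℝ) + 1)) ^ ((p - 2) / 2) := by positivity
      simp only [hF, hbd, norm_mul, Real.norm_eq_abs, abs_of_nonneg (Real.sqrt_nonneg _),
        abs_of_nonneg hw]
      refine mul_le_mul_of_nonneg_left ?_ (Real.sqrt_nonneg _)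
      refine (mul_le_mul_of_nonneg_left hr hw).trans ?_
      rw [← mul_assoc]
      exact mul_le_mul_of_nonneg_right (rpow_mul_sqrt_le hp hq hk hk1) (Real.sqrt_nonneg _)
    · simp [hF, hbd, hr0 _ y hy]
  have hlim : ∀ᵐ y, Tendsto (fun k ↦ F k y) atTop
      (𝓝 (√(G y).det * (√(coordPairing G u u y) ^ (p - 2) * coordPairing G u ψ y))) := by
    refine Eventually.of_forall fun y ↦ ?_
    by_cases hy : y ∈ tsupport ψ
    · have hP := hpos y (hψΩ hy)
      refine (tendsto_regularized (coordPairing_self_nonneg hP) fun h0 ↦ ?_).const_mul _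
      have := coordPairing_sq_le (u := u) (v := ψ) hP
      rw [h0, zero_mul] at this
      exact pow_eq_zero_iff two_ne_zero |>.1 (le_antisymm this (sq_nonneg _))
    · simp [hF, hr0 _ y hy]
  refine ⟨⟨aestronglyMeasurable_of_tendsto_ae _ (fun k ↦ (hFk k).1.1) hlim,
    hasFiniteIntegral_of_dominated_convergence hbound.2 hle hlim⟩, ?_⟩
  exact le_of_tendsto' (tendsto_integral_of_dominated_convergence bound (fun k ↦ (hFk k).1.1)
    hbound hle hlim) fun k ↦ (hFk k).2

end Integration

/-! ### The metric, gradient and Hessian read in a chart -/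

section Chart

open Filter Topology

variable {n : ℕ} {M : Type*} [TopologicalSpace M] [ChartedSpace (EuclideanSpace ℝ (Fin n)) M]
  [IsManifold (𝓡 n) ∞ M]
  {e : OpenPartialHomeomorph M (EuclideanSpace ℝ (Fin n))}

/-- The coordinate field is the image of a constant field under the tangent map of `e.symm`; one
derivative is lost, so `e.symm` is taken of class `C²`. -/
theorem contMDiffOn_coordVector (he : e ∈ atlas (EuclideanSpace ℝ (Fin n)) M) (i : Fin n) :
    ContMDiffOn (𝓡 n) (𝓡 n).tangent 1
      (fun y ↦ (⟨e.symm y, coordVector e y i⟩ : TangentBundle (𝓡 n) M)) e.target := by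
  have h1 : ContMDiffOn (𝓡 n) (𝓡 n) 2 e.symm e.target :=
    (contMDiffOn_symm_of_mem_maximalAtlas (n := ∞)
      (IsManifold.subset_maximalAtlas he)).of_le ENat.LEInfty.out
  have h2 := h1.contMDiffOn_tangentMapWithin (m := 1) (by norm_num)
    e.open_target.uniqueMDiffOn
  have h3 : ContMDiff (𝓡 n) (𝓡 n).tangent 1 (fun y : EuclideanSpace ℝ (Fin n) ↦
      (⟨y, (EuclideanSpace.single i (1 : ℝ) : EuclideanSpace ℝ (Fin n))⟩ :
        TangentBundle (𝓡 n) (EuclideanSpace ℝ (Fin n)))) :=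
    contMDiff_vectorSpace_iff_contDiff.2 contDiff_const
  refine (h2.comp h3.contMDiffOn fun y hy ↦ hy).congr fun y hy ↦ ?_
  simp only [Function.comp, tangentMapWithin, mfderivWithin_of_isOpen e.open_target hy]
  rfl

theorem bijective_mfderiv_symm (he : e ∈ atlas (EuclideanSpace ℝ (Fin n)) M)
    {y : EuclideanSpace ℝ (Fin n)} (hy : y ∈ e.target) :
    Function.Bijective (mfderiv (𝓡 n) (𝓡 n) e.symm y) :=
  have := IsManifold.of_le (I := 𝓡 n) (M := M) (m := 1) (n := ∞) (by exact_mod_cast le_top)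
  (mdifferentiable_of_mem_atlas (I := 𝓡 n) he).symm.mfderiv_bijective hy

theorem linearIndependent_coordVector (he : e ∈ atlas (EuclideanSpace ℝ (Fin n)) M)
    {y : EuclideanSpace ℝ (Fin n)} (hy : y ∈ e.target) :
    LinearIndependent ℝ (coordVector e y) := by
  have h := (EuclideanSpace.basisFun (Fin n) ℝ).toBasis.linearIndependent.map'
    (mfderiv (𝓡 n) (𝓡 n) e.symm y).toLinearMap
    (LinearMap.ker_eq_bot.2 (bijective_mfderiv_symm he hy).1)
  have heq : coordVector e y = fun i ↦ mfderiv (𝓡 n) (𝓡 n) e.symm y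
      ((EuclideanSpace.basisFun (Fin n) ℝ).toBasis i) := by
    ext1 i
    rw [OrthonormalBasis.coe_toBasis, EuclideanSpace.basisFun_apply]
    rfl
  rw [heq]
  exact h

theorem partialDeriv_comp_symm (he : e ∈ atlas (EuclideanSpace ℝ (Fin n)) M) {f : M → ℝ}
    {y : EuclideanSpace ℝ (Fin n)} (hy : y ∈ e.target)
    (hf : MDifferentiableAt (𝓡 n) 𝓘(ℝ, ℝ) f (e.symm y)) (i : Fin n) :
    partialDeriv i (f ∘ e.symm) y = mvfderiv (𝓡 n) f (e.symm y) (coordVector e y i) := by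
  have := IsManifold.of_le (I := 𝓡 n) (M := M) (m := 1) (n := ∞) (by exact_mod_cast le_top)
  have hs := mdifferentiableAt_atlas_symm (I := 𝓡 n) he hy
  have h := mfderiv_comp_apply y hf hs (EuclideanSpace.single i (1 : ℝ) : EuclideanSpace ℝ (Fin n))
  rw [mfderiv_eq_fderiv] at h
  exact h

section Metric

variable [RiemannianBundle (fun x : M ↦ TangentSpace (𝓡 n) x)]

theorem metricMatrix_posDef (he : e ∈ atlas (EuclideanSpace ℝ (Fin n)) M)
    {y : EuclideanSpace ℝ (Fin n)} (hy : y ∈ e.target) : (metricMatrix e y).PosDef :=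
  posDef_gram_of_linearIndependent (𝕜 := ℝ) (linearIndependent_coordVector he hy)

theorem contDiffOn_metricMatrix
    [IsContMDiffRiemannianBundle (𝓡 n) ∞ (EuclideanSpace ℝ (Fin n))
      (fun x : M ↦ TangentSpace (𝓡 n) x)]
    (he : e ∈ atlas (EuclideanSpace ℝ (Fin n)) M) (i j : Fin n) :
    ContDiffOn ℝ 1 (fun y ↦ metricMatrix e y i j) e.target := by
  rw [← contMDiffOn_iff_contDiffOn]
  have : IsContMDiffRiemannianBundle (𝓡 n) 1 (EuclideanSpace ℝ (Fin n))
      (fun x : M ↦ TangentSpace (𝓡 n) x) :=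
    IsContMDiffRiemannianBundle.of_le (n := ∞) (by exact_mod_cast le_top)
  exact (contMDiffOn_coordVector he i).inner_bundle (contMDiffOn_coordVector he j)

omit [IsManifold (𝓡 n) ∞ M] in
theorem riemGrad_inner (f : M → ℝ) (x : M) (v : TangentSpace (𝓡 n) x) :
    inner ℝ (riemGrad n f x) v = mvfderiv (𝓡 n) f x v := by
  have : FiniteDimensional ℝ (TangentSpace (𝓡 n) x) :=
    inferInstanceAs (FiniteDimensional ℝ (EuclideanSpace ℝ (Fin n)))
  have : CompleteSpace (TangentSpace (𝓡 n) x) := FiniteDimensional.complete ℝ _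
  exact InnerProductSpace.toDual_symm_apply

theorem inner_riemGrad_eq_coordPairing (he : e ∈ atlas (EuclideanSpace ℝ (Fin n)) M)
    {f φ : M → ℝ} {y : EuclideanSpace ℝ (Fin n)} (hy : y ∈ e.target)
    (hf : MDifferentiableAt (𝓡 n) 𝓘(ℝ, ℝ) f (e.symm y))
    (hφ : MDifferentiableAt (𝓡 n) 𝓘(ℝ, ℝ) φ (e.symm y)) :
    inner ℝ (riemGrad n f (e.symm y)) (riemGrad n φ (e.symm y))
      = coordPairing (metricMatrix e) (f ∘ e.symm) (φ ∘ e.symm) y := by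
  have hdet := (metricMatrix_posDef he hy).det_pos.ne'.isUnit
  have hgrad : riemGrad n f (e.symm y)
      = ∑ i, coordGrad (metricMatrix e) (f ∘ e.symm) y i • coordVector e y i := by
    have hspan : ⊤ ≤ Submodule.span ℝ (Set.range (coordVector e y)) := by
      have : FiniteDimensional ℝ (TangentSpace (𝓡 n) (e.symm y)) :=
        inferInstanceAs (FiniteDimensional ℝ (EuclideanSpace ℝ (Fin n)))
      have h := (linearIndependent_coordVector he hy).span_eq_top_of_card_eq_finrank'
        ((Fintype.card_fin n).trans (finrank_euclideanSpace_fin (𝕜 := ℝ)).symm)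
      exact h.ge
    refine ext_inner_right ℝ fun v ↦ ?_
    rw [riemGrad_inner]
    -- Both functionals are compared on the coordinate basis, where equality is the linear system `g
    -- X = du`.
    have hlin : (mvfderiv (𝓡 n) f (e.symm y)).toLinearMap = (innerSL ℝ (∑ i, coordGrad
        (metricMatrix e) (f ∘ e.symm) y i • coordVector e y i)).toLinearMap := by
      refine LinearMap.ext_on (top_le_iff.1 hspan) ?_
      rintro _ ⟨j, rfl⟩
      have h : metricMatrix e y *ᵥ coordGrad (metricMatrix e) (f ∘ e.symm) y
          = fun j ↦ partialDeriv j (f ∘ e.symm) y := by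
        rw [coordGrad, mulVec_mulVec, mul_nonsing_inv _ hdet, one_mulVec]
      have hj := congrFun h j
      simp only [partialDeriv_comp_symm he hy hf] at hj
      change mvfderiv (𝓡 n) f (e.symm y) (coordVector e y j) = inner ℝ (∑ i, coordGrad
        (metricMatrix e) (f ∘ e.symm) y i • coordVector e y i) (coordVector e y j)
      rw [← hj, sum_inner, mulVec, dotProduct]
      refine Finset.sum_congr rfl fun i _ ↦ ?_
      rw [real_inner_smul_left, real_inner_comm, mul_comm]
      rfl
    exact congrArg (fun L : TangentSpace (𝓡 n) (e.symm y) →ₗ[ℝ] ℝ ↦ L v) hlin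
  rw [hgrad, sum_inner, coordPairing, dotProduct]
  refine Finset.sum_congr rfl fun i _ ↦ ?_
  rw [real_inner_smul_left, real_inner_comm, riemGrad_inner]
  exact congrArg _ (partialDeriv_comp_symm he hy hφ i).symm

theorem pFlux_eq (he : e ∈ atlas (EuclideanSpace ℝ (Fin n)) M) (p : ℝ)
    {f φ : M → ℝ} {y : EuclideanSpace ℝ (Fin n)} (hy : y ∈ e.target)
    (hf : MDifferentiableAt (𝓡 n) 𝓘(ℝ, ℝ) f (e.symm y))
    (hφ : MDifferentiableAt (𝓡 n) 𝓘(ℝ, ℝ) φ (e.symm y)) :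
    pFlux n p f φ (e.symm y)
      = √(coordPairing (metricMatrix e) (f ∘ e.symm) (f ∘ e.symm) y) ^ (p - 2)
        * coordPairing (metricMatrix e) (f ∘ e.symm) (φ ∘ e.symm) y := by
  rw [pFlux, ← inner_riemGrad_eq_coordPairing he hy hf hf,
    ← inner_riemGrad_eq_coordPairing he hy hf hφ, ← norm_eq_sqrt_real_inner]

omit [IsManifold (𝓡 n) ∞ M] in
theorem hessian_eq_coordHessian (f : M → ℝ) (y : EuclideanSpace ℝ (Fin n)) :
    hessian e f y = coordHessian (metricMatrix e) (f ∘ e.symm) y := by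
  ext i j
  simp only [hessian, coordHessian, algHessian, christoffel]
  congr 1

end Metric
end Chart

/-! ### The Riemannian volume and its independence of charts -/

section Volume

open Filter Topology

variable {n : ℕ} {M : Type*} [TopologicalSpace M] [ChartedSpace (EuclideanSpace ℝ (Fin n)) M]
  [RiemannianBundle (fun x : M ↦ TangentSpace (𝓡 n) x)]
  {e e' : OpenPartialHomeomorph M (EuclideanSpace ℝ (Fin n))}

section Transition

variable [IsManifold (𝓡 n) ∞ M]

omit [RiemannianBundle (fun x : M ↦ TangentSpace (𝓡 n) x)] in
theorem differentiableAt_transition (he : e ∈ atlas (EuclideanSpace ℝ (Fin n)) M)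
    (he' : e' ∈ atlas (EuclideanSpace ℝ (Fin n)) M) {y : EuclideanSpace ℝ (Fin n)}
    (hy : y ∈ e.target) (hy' : e.symm y ∈ e'.source) : DifferentiableAt ℝ (e' ∘ e.symm) y := by
  have := IsManifold.of_le (I := 𝓡 n) (M := M) (m := 1) (n := ∞) (by exact_mod_cast le_top)
  exact ((mdifferentiableAt_atlas (I := 𝓡 n) he' hy').comp y
    (mdifferentiableAt_atlas_symm (I := 𝓡 n) he hy)).differentiableAt

/-- The metric at `x`, on vectors of the model space. -/
def modelInner (x : M) (v w : EuclideanSpace ℝ (Fin n)) : ℝ :=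
  @inner ℝ (TangentSpace (𝓡 n) x) _ v w

/-- The derivative of the inverse of a chart, as an endomorphism of the model space. -/
def coordDeriv (e : OpenPartialHomeomorph M (EuclideanSpace ℝ (Fin n)))
    (y : EuclideanSpace ℝ (Fin n)) : EuclideanSpace ℝ (Fin n) →L[ℝ] EuclideanSpace ℝ (Fin n) :=
  mfderiv (𝓡 n) (𝓡 n) e.symm y

theorem metricMatrix_transition (he : e ∈ atlas (EuclideanSpace ℝ (Fin n)) M)
    (he' : e' ∈ atlas (EuclideanSpace ℝ (Fin n)) M) {y : EuclideanSpace ℝ (Fin n)}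
    (hy : y ∈ e.target) (hy' : e.symm y ∈ e'.source) :
    metricMatrix e y
      = (LinearMap.toMatrix (EuclideanSpace.basisFun (Fin n) ℝ).toBasis
          (EuclideanSpace.basisFun (Fin n) ℝ).toBasis (fderiv ℝ (e' ∘ e.symm) y).toLinearMap)ᵀ
        * metricMatrix e' (e' (e.symm y))
        * LinearMap.toMatrix (EuclideanSpace.basisFun (Fin n) ℝ).toBasis
          (EuclideanSpace.basisFun (Fin n) ℝ).toBasis (fderiv ℝ (e' ∘ e.symm) y).toLinearMap := by
  have := IsManifold.of_le (I := 𝓡 n) (M := M) (m := 1) (n := ∞) (by exact_mod_cast le_top)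
  set T := fderiv ℝ (e' ∘ e.symm) y with hT
  set J := LinearMap.toMatrix (EuclideanSpace.basisFun (Fin n) ℝ).toBasis
          (EuclideanSpace.basisFun (Fin n) ℝ).toBasis T.toLinearMap with hJ
  have hτ := differentiableAt_transition he he' hy hy'
  have hD : coordDeriv e y = coordDeriv e' (e' (e.symm y)) ∘L T := by
    have heq : e.symm =ᶠ[𝓝 y] e'.symm ∘ (e' ∘ e.symm) := by
      filter_upwards [(e.symm.continuousAt hy).preimage_mem_nhds (e'.open_source.mem_nhds hy')]
        with z hz using (e'.left_inv hz).symm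
    have h1 := mfderiv_comp y (mdifferentiableAt_atlas_symm (I := 𝓡 n) he'
      (e'.map_source hy')) hτ.mdifferentiableAt
    rw [mfderiv_eq_fderiv] at h1
    exact heq.mfderiv_eq.trans h1
  have hcv : ∀ i, coordDeriv e y (EuclideanSpace.single i 1)
      = ∑ a, J a i • coordDeriv e' (e' (e.symm y)) (EuclideanSpace.single a 1) := by
    intro i
    have h2 : T (EuclideanSpace.single i 1) = ∑ a, J a i • EuclideanSpace.single a (1 : ℝ) := by
      refine ((EuclideanSpace.basisFun (Fin n) ℝ).toBasis.sum_repr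
        (T (EuclideanSpace.single i 1))).symm.trans ?_
      simp [hJ, LinearMap.toMatrix_apply]
    rw [hD, ContinuousLinearMap.comp_apply, h2, map_sum]
    simp only [map_smul]
  ext i j
  -- The base points `e.symm y` and `e'.symm (e' (e.symm y))` are equal but give different tangent
  -- space types. With the vectors in the model space, the base point can be rewritten.
  have h3 : metricMatrix e y i j = modelInner (e'.symm (e' (e.symm y)))
      (coordDeriv e y (EuclideanSpace.single i 1))
      (coordDeriv e y (EuclideanSpace.single j 1)) := by
    rw [e'.left_inv hy']; rfl
  rw [h3, hcv i, hcv j]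
  change inner ℝ (∑ a, J a i • coordVector e' (e' (e.symm y)) a)
    (∑ a, J a j • coordVector e' (e' (e.symm y)) a) = _
  rw [sum_inner]
  simp only [inner_sum, real_inner_smul_left, real_inner_smul_right, mul_apply, transpose_apply,
    Finset.sum_mul]
  rw [Finset.sum_comm]
  refine Finset.sum_congr rfl fun b _ ↦ Finset.sum_congr rfl fun a _ ↦ ?_
  rw [mul_left_comm, mul_comm (J b j), ← mul_assoc]
  rfl

theorem sqrt_det_metricMatrix_transition (he : e ∈ atlas (EuclideanSpace ℝ (Fin n)) M)
    (he' : e' ∈ atlas (EuclideanSpace ℝ (Fin n)) M) {y : EuclideanSpace ℝ (Fin n)}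
    (hy : y ∈ e.target) (hy' : e.symm y ∈ e'.source) :
    √(metricMatrix e y).det
      = |(fderiv ℝ (e' ∘ e.symm) y).det| * √(metricMatrix e' (e' (e.symm y))).det := by
  rw [metricMatrix_transition he he' hy hy', det_mul, det_mul, det_transpose,
    LinearMap.det_toMatrix, mul_comm, ← mul_assoc, ← sq, Real.sqrt_mul (sq_nonneg _),
    Real.sqrt_sq_eq_abs]

end Transition

variable [MeasurableSpace M] [BorelSpace M]

theorem aemeasurable_symm :
    AEMeasurable e.symm ((volume.restrict e.target).withDensity
      fun y ↦ ENNReal.ofReal √(metricMatrix e y).det) :=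
  (e.continuousOn_symm.aemeasurable e.open_target.measurableSet).mono_ac
    (withDensity_absolutelyContinuous _ _)

theorem chartVolume_apply {S : Set M} (hS : MeasurableSet S) :
    chartVolume e S = ∫⁻ y in e.symm ⁻¹' S ∩ e.target, ENNReal.ofReal √(metricMatrix e y).det := by
  rw [chartVolume, Measure.map_apply_of_aemeasurable aemeasurable_symm hS, withDensity_apply',
    Measure.restrict_restrict' e.open_target.measurableSet]

omit [ChartedSpace (EuclideanSpace ℝ (Fin n)) M]
  [RiemannianBundle (fun x : M ↦ TangentSpace (𝓡 n) x)] in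
theorem measurableSet_preimage_symm {S : Set M} (hS : MeasurableSet S) :
    MeasurableSet (e.symm ⁻¹' S ∩ e.target) := by
  have h : Measurable (e.target.domRestrict e.symm) :=
    (continuousOn_iff_continuous_domRestrict.1 e.continuousOn_symm).measurable
  convert e.open_target.measurableSet.subtype_image (h hS) using 1
  ext y
  simp [and_comm]

theorem chartVolume_inter_source {S : Set M} (hS : MeasurableSet S) :
    chartVolume e (S ∩ e.source) = chartVolume e S := by
  rw [chartVolume_apply hS, chartVolume_apply (hS.inter e.open_source.measurableSet)]
  congr 2
  ext y
  simp only [Set.mem_inter_iff, Set.mem_preimage]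
  exact ⟨fun h ↦ ⟨h.1.1, h.2⟩, fun h ↦ ⟨⟨h.1, e.map_target h.2⟩, h.2⟩⟩

/-- The density `√det g` transforms by the absolute Jacobian of the transition map, which is exactly
the factor in the change of variables formula. -/
theorem chartVolume_eq_chartVolume [IsManifold (𝓡 n) ∞ M]
    (he : e ∈ atlas (EuclideanSpace ℝ (Fin n)) M)
    (he' : e' ∈ atlas (EuclideanSpace ℝ (Fin n)) M) {S : Set M} (hS : MeasurableSet S)
    (hSe : S ⊆ e.source) (hSe' : S ⊆ e'.source) : chartVolume e S = chartVolume e' S := by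
  rw [chartVolume_apply hS, chartVolume_apply hS]
  set A := e.symm ⁻¹' S ∩ e.target with hA
  have himage : e'.symm ⁻¹' S ∩ e'.target = (e' ∘ e.symm) '' A := by
    ext z
    constructor
    · rintro ⟨hz, hzt⟩
      have hz' := hSe hz
      refine ⟨e (e'.symm z), ⟨?_, e.map_source hz'⟩, ?_⟩
      · rw [Set.mem_preimage, e.left_inv hz']; exact hz
      · rw [Function.comp, e.left_inv hz', e'.right_inv hzt]
    · rintro ⟨y, ⟨hy, hyt⟩, rfl⟩
      refine ⟨?_, e'.map_source (hSe' hy)⟩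
      rw [Set.mem_preimage, Function.comp, e'.left_inv (hSe' hy)]
      exact hy
  have hinj : Set.InjOn (e' ∘ e.symm) A := by
    rintro y ⟨hy, hyt⟩ z ⟨hz, hzt⟩ h
    exact e.symm.injOn hyt hzt (e'.injOn (hSe' hy) (hSe' hz) h)
  rw [himage, lintegral_image_eq_lintegral_abs_det_fderiv_mul volume
    (measurableSet_preimage_symm hS) (fun y hy ↦ (differentiableAt_transition he he' hy.2
      (hSe' hy.1)).hasFDerivAt.hasFDerivWithinAt) hinj]
  refine setLIntegral_congr_fun (measurableSet_preimage_symm hS) fun y hy ↦ ?_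
  simp only [sqrt_det_metricMatrix_transition he he' hy.2 (hSe' hy.1)]
  rw [ENNReal.ofReal_mul (abs_nonneg _)]
  rfl

section Global

variable [SecondCountableTopology M]

omit [RiemannianBundle (fun x : M ↦ TangentSpace (𝓡 n) x)] in
theorem measurableSet_chartPiece (c : chartCenters n M) : MeasurableSet (chartPiece n c) :=
  (OpenPartialHomeomorph.open_source _).measurableSet.diff
    (isOpen_iUnion fun _ ↦ isOpen_iUnion fun _ ↦ OpenPartialHomeomorph.open_source _).measurableSet

omit [RiemannianBundle (fun x : M ↦ TangentSpace (𝓡 n) x)] [MeasurableSpace M] [BorelSpace M] in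
theorem pairwise_disjoint_chartPiece :
    Pairwise (Function.onFun Disjoint (chartPiece n : chartCenters n M → Set M)) := by
  have hinj : Function.Injective (chartIndex n M) :=
    ((exists_countable_chart_cover n M).choose_spec.1.exists_injective_nat).choose_spec
  intro c d hcd
  refine Set.disjoint_left.2 fun x hc hd ↦ ?_
  rcases lt_or_gt_of_ne (hinj.ne hcd) with h | h
  · exact hd.2 (Set.mem_iUnion₂.2 ⟨c, h, hc.1⟩)
  · exact hc.2 (Set.mem_iUnion₂.2 ⟨d, h, hd.1⟩)

omit [RiemannianBundle (fun x : M ↦ TangentSpace (𝓡 n) x)] [MeasurableSpace M] [BorelSpace M] in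
theorem iUnion_chartPiece : ⋃ c : chartCenters n M, chartPiece n c = Set.univ := by
  refine Set.eq_univ_of_forall fun x ↦ ?_
  have hx : x ∈ ⋃ c ∈ chartCenters n M, (chartAt (EuclideanSpace ℝ (Fin n)) c).source := by
    exact (exists_countable_chart_cover n M).choose_spec.2.symm ▸ Set.mem_univ x
  obtain ⟨c, hc, hxc⟩ := Set.mem_iUnion₂.1 hx
  -- A point lies in the piece of the chart of least index among those containing it.
  obtain ⟨d, hd, hmin⟩ := (measure (chartIndex n M)).wf.has_min
    {d : chartCenters n M | x ∈ (chartAt (EuclideanSpace ℝ (Fin n)) (d : M)).source} ⟨⟨c, hc⟩, hxc⟩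
  refine Set.mem_iUnion.2 ⟨d, hd, fun h ↦ ?_⟩
  obtain ⟨b, hb, hxb⟩ := Set.mem_iUnion₂.1 h
  exact hmin b hxb hb

/-- On a chart domain, the Riemannian volume is the volume of the chart. -/
theorem riemannianVolume_restrict_source [IsManifold (𝓡 n) ∞ M]
    (he : e ∈ atlas (EuclideanSpace ℝ (Fin n)) M) :
    (riemannianVolume n M).restrict e.source = chartVolume e := by
  have : Countable (chartCenters n M) :=
    (exists_countable_chart_cover n M).choose_spec.1.to_subtype
  ext S hS
  have hSe := hS.inter e.open_source.measurableSet
  rw [Measure.restrict_apply hS, riemannianVolume, Measure.sum_apply _ hSe,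
    ← chartVolume_inter_source hS]
  -- Each piece is remeasured in the fixed chart `e`; countable additivity over the partition then
  -- reassembles the set.
  have hpiece : ∀ c : chartCenters n M,
      (chartVolume (chartAt (EuclideanSpace ℝ (Fin n)) (c : M))).restrict (chartPiece n c)
        (S ∩ e.source) = chartVolume e (S ∩ e.source ∩ chartPiece n c) := fun c ↦ by
    rw [Measure.restrict_apply hSe]
    exact chartVolume_eq_chartVolume (chart_mem_atlas _ _) he
      (hSe.inter (measurableSet_chartPiece c)) (fun x hx ↦ hx.2.1) fun x hx ↦ hx.1.2
  simp only [hpiece]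
  rw [← measure_iUnion (fun c d hcd ↦ (pairwise_disjoint_chartPiece hcd).mono
    Set.inter_subset_right Set.inter_subset_right)
    fun c ↦ hSe.inter (measurableSet_chartPiece c), ← Set.inter_iUnion, iUnion_chartPiece,
    Set.inter_univ]

theorem integral_riemannianVolume_of_support [IsManifold (𝓡 n) ∞ M]
    [IsContMDiffRiemannianBundle (𝓡 n) ∞ (EuclideanSpace ℝ (Fin n))
      (fun x : M ↦ TangentSpace (𝓡 n) x)]
    (he : e ∈ atlas (EuclideanSpace ℝ (Fin n)) M) {h : M → ℝ} (h0 : ∀ x ∉ e.source, h x = 0)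
    (hint : IntegrableOn (fun y ↦ √(metricMatrix e y).det * h (e.symm y)) e.target) :
    Integrable h (riemannianVolume n M) ∧
      ∫ x, h x ∂(riemannianVolume n M)
        = ∫ y in e.target, √(metricMatrix e y).det * h (e.symm y) := by
  set ρ : EuclideanSpace ℝ (Fin n) → ENNReal := fun y ↦ ENNReal.ofReal √(metricMatrix e y).det
    with hρ
  set μ := (volume.restrict e.target).withDensity ρ with hμ
  have hρm : AEMeasurable ρ (volume.restrict e.target) := by
    refine ENNReal.measurable_ofReal.comp_aemeasurable
      (ContinuousOn.aemeasurable (fun y hy ↦ ?_) e.open_target.measurableSet)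
    exact (contDiffAt_det fun i j ↦ (contDiffOn_metricMatrix he i j).contDiffAt
      (e.open_target.mem_nhds hy)).continuousAt.sqrt.continuousWithinAt
  have hρr : ∀ y, (ρ y).toReal = √(metricMatrix e y).det := fun y ↦
    ENNReal.toReal_ofReal (Real.sqrt_nonneg _)
  have hk : Integrable (fun y ↦ h (e.symm y)) μ := by
    rw [hμ, integrable_withDensity_iff_integrable_smul₀' hρm
      (Eventually.of_forall fun y ↦ ENNReal.ofReal_lt_top)]
    simp only [hρr, smul_eq_mul]
    exact hint
  have hμt : ∀ᵐ y ∂μ, y ∈ e.target :=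
    (withDensity_absolutelyContinuous _ _).ae_le (ae_restrict_mem e.open_target.measurableSet)
  have hvol : chartVolume e = μ.map e.symm := rfl
  have hrestr : (chartVolume e).restrict e.source = chartVolume e := by
    rw [← riemannianVolume_restrict_source he, Measure.restrict_restrict_of_subset subset_rfl]
  have hem : AEMeasurable e (chartVolume e) := by
    rw [← hrestr]
    exact e.continuousOn.aemeasurable e.open_source.measurableSet
  have hmap : (chartVolume e).map e = μ := by
    rw [hvol, AEMeasurable.map_map_of_aemeasurable (hvol ▸ hem) aemeasurable_symm]
    have hid : e ∘ e.symm =ᵐ[μ] id := hμt.mono fun y hy ↦ e.right_inv hy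
    exact (Measure.map_congr hid).trans Measure.map_id
  -- On the chart domain, which carries the measure, `h` is its coordinate expression composed with
  -- `e`, so measurability in coordinates transfers.
  have hmeas : AEStronglyMeasurable h (chartVolume e) := by
    have h1 : AEStronglyMeasurable ((fun y ↦ h (e.symm y)) ∘ e) (chartVolume e) :=
      AEStronglyMeasurable.comp_aemeasurable (hmap ▸ hk.1) hem
    refine h1.congr ?_
    rw [← hrestr]
    filter_upwards [ae_restrict_mem e.open_source.measurableSet] with x hx
    simp only [Function.comp, e.left_inv hx]
  have hcv : Integrable h (chartVolume e) :=
    (integrable_map_measure (hvol ▸ hmeas) aemeasurable_symm).2 hk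
  constructor
  · rw [← riemannianVolume_restrict_source he] at hcv
    exact (integrableOn_iff_integrable_of_support_subset
      fun x hx ↦ by_contra fun hn ↦ hx (h0 x hn)).1 hcv
  · rw [← setIntegral_eq_integral_of_forall_compl_eq_zero h0,
      riemannianVolume_restrict_source he, hvol,
      integral_map aemeasurable_symm (hvol ▸ hmeas),
      integral_withDensity_eq_integral_toReal_smul₀ hρm
        (Eventually.of_forall fun y ↦ ENNReal.ofReal_lt_top)]
    simp only [hρr, smul_eq_mul]

end Global
end Volume

/-! ### The weak inequality: one chart, then a partition of unity -/

section WeakInequality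

open Filter Topology

variable {n : ℕ} {M : Type*} [TopologicalSpace M]
  [ChartedSpace (EuclideanSpace ℝ (Fin n)) M] [IsManifold (𝓡 n) ∞ M]
  {e : OpenPartialHomeomorph M (EuclideanSpace ℝ (Fin n))}

/-- A smooth function with compact support in a chart domain, read in the chart and extended by
zero. -/
theorem exists_contDiff_extension (he : e ∈ atlas (EuclideanSpace ℝ (Fin n)) M) {φ : M → ℝ}
    (hφ : ContMDiff (𝓡 n) 𝓘(ℝ, ℝ) ∞ φ) (hφc : HasCompactSupport φ) (hφe : tsupport φ ⊆ e.source)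
    (hφ0 : ∀ x, 0 ≤ φ x) :
    ∃ ψ : EuclideanSpace ℝ (Fin n) → ℝ, ContDiff ℝ 1 ψ ∧ HasCompactSupport ψ ∧
      tsupport ψ ⊆ e.target ∧ (∀ y, 0 ≤ ψ y) ∧ Set.EqOn ψ (φ ∘ e.symm) e.target := by
  have hK : IsCompact (e '' tsupport φ) := hφc.isCompact.image_of_continuousOn
    (e.continuousOn.mono hφe)
  have hKt : e '' tsupport φ ⊆ e.target := by
    rintro _ ⟨x, hx, rfl⟩
    exact e.map_source (hφe hx)
  have heq : Set.EqOn (e.target.indicator (φ ∘ e.symm)) (φ ∘ e.symm) e.target :=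
    Set.eqOn_indicator
  have hzero : ∀ y ∉ e '' tsupport φ, e.target.indicator (φ ∘ e.symm) y = 0 := by
    intro y hy
    by_cases hyt : y ∈ e.target
    · rw [Set.indicator_of_mem hyt]
      exact image_eq_zero_of_notMem_tsupport (f := φ) fun h ↦ hy ⟨_, h, e.right_inv hyt⟩
    · exact Set.indicator_of_notMem hyt _
  have hsub : tsupport (e.target.indicator (φ ∘ e.symm)) ⊆ e '' tsupport φ :=
    closure_minimal (fun y hy ↦ by_contra fun hn ↦ hy (hzero y hn)) hK.isClosed
  refine ⟨e.target.indicator (φ ∘ e.symm), contDiff_iff_contDiffAt.2 fun y ↦ ?_,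
    hK.of_isClosed_subset (isClosed_tsupport _) hsub, hsub.trans hKt,
    Set.indicator_nonneg fun y _ ↦ hφ0 _, heq⟩
  -- Two open sets cover the space: the chart target, where the extension is `φ ∘ e.symm`, and the
  -- complement of this compact image, where it is zero.
  by_cases hy : y ∈ e '' tsupport φ
  · have hyt := hKt hy
    have hs := (contMDiffOn_symm_of_mem_maximalAtlas (I := 𝓡 n) (n := ∞)
      (IsManifold.subset_maximalAtlas he)).contMDiffAt (e.open_target.mem_nhds hyt)
    have h1 : ContDiffAt ℝ ∞ (φ ∘ e.symm) y := (hφ.contMDiffAt.comp y hs).contDiffAt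
    exact (h1.of_le ENat.LEInfty.out).congr_of_eventuallyEq
      (heq.eventuallyEq_of_mem (e.open_target.mem_nhds hyt))
  · exact (contDiffAt_const (c := (0 : ℝ))).congr_of_eventuallyEq
      (eventually_of_mem (hK.isClosed.isOpen_compl.mem_nhds hy) hzero)

variable [RiemannianBundle (fun x : M ↦ TangentSpace (𝓡 n) x)]

omit [IsManifold (𝓡 n) ∞ M] in
theorem pFlux_eq_zero_of_notMem_tsupport {p : ℝ} {f φ : M → ℝ} {x : M} (hx : x ∉ tsupport φ) :
    pFlux n p f φ x = 0 := by
  have h : φ =ᶠ[𝓝 x] fun _ ↦ (0 : ℝ) := notMem_tsupport_iff_eventuallyEq.1 hx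
  have hd : mvfderiv (𝓡 n) φ x = 0 := by
    rw [mvfderiv, h.mfderiv_eq, mfderiv_const]
    ext v
    rfl
  rw [pFlux, real_inner_comm, riemGrad_inner, hd, _root_.zero_apply, mul_zero]

omit [IsManifold (𝓡 n) ∞ M] in
theorem pFlux_add {p : ℝ} {f φ χ : M → ℝ} {x : M} (hφ : MDifferentiableAt (𝓡 n) 𝓘(ℝ, ℝ) φ x)
    (hχ : MDifferentiableAt (𝓡 n) 𝓘(ℝ, ℝ) χ x) :
    pFlux n p f (φ + χ) x = pFlux n p f φ x + pFlux n p f χ x := by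
  rw [pFlux, pFlux, pFlux, real_inner_comm, riemGrad_inner, mvfderiv_add hφ hχ,
    real_inner_comm (riemGrad n φ x), real_inner_comm (riemGrad n χ x), riemGrad_inner,
    riemGrad_inner, _root_.add_apply, mul_add]

variable [SecondCountableTopology M]
  [IsContMDiffRiemannianBundle (𝓡 n) ∞ (EuclideanSpace ℝ (Fin n))
    (fun x : M ↦ TangentSpace (𝓡 n) x)]
  [MeasurableSpace M] [BorelSpace M] {f : M → ℝ} {p : ℝ}

/-- The weak inequality for test functions supported in a chart domain. -/
theorem integral_pFlux_nonpos_of_tsupport_subset_source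
    (hf : ContMDiff (𝓡 n) 𝓘(ℝ, ℝ) 2 f) (hconv : IsConvex n f) (hp : 1 < p)
    (he : e ∈ atlas (EuclideanSpace ℝ (Fin n)) M) {φ : M → ℝ}
    (hφ : ContMDiff (𝓡 n) 𝓘(ℝ, ℝ) ∞ φ) (hφc : HasCompactSupport φ) (hφe : tsupport φ ⊆ e.source)
    (hφ0 : ∀ x, 0 ≤ φ x) :
    Integrable (pFlux n p f φ) (riemannianVolume n M) ∧
      ∫ x, pFlux n p f φ x ∂(riemannianVolume n M) ≤ 0 := by
  obtain ⟨ψ, hψ, hψc, hψe, hψ0, hψφ⟩ := exists_contDiff_extension he hφ hφc hφe hφ0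
  have hu : ContDiffOn ℝ 2 (f ∘ e.symm) e.target := by
    have hs : ContMDiffOn (𝓡 n) (𝓡 n) 2 e.symm e.target :=
      (contMDiffOn_symm_of_mem_maximalAtlas (n := ∞)
        (IsManifold.subset_maximalAtlas he)).of_le ENat.LEInfty.out
    exact (hf.comp_contMDiffOn hs).contDiffOn
  have hH : ∀ y ∈ e.target, ∀ v : Fin n → ℝ,
      0 ≤ ∑ i, ∑ j, coordHessian (metricMatrix e) (f ∘ e.symm) y i j * v i * v j := by
    intro y hy v
    have h := hconv e he (e.symm y) (e.map_target hy) v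
    rwa [e.right_inv hy, hessian_eq_coordHessian] at h
  obtain ⟨hint, hle⟩ := integral_coordFlux_nonpos hp e.open_target (contDiffOn_metricMatrix he)
    (fun y hy ↦ metricMatrix_posDef he hy) hu hH hψ hψc hψe hψ0
  have hflux : ∀ y ∈ e.target, √(metricMatrix e y).det * pFlux n p f φ (e.symm y)
      = √(metricMatrix e y).det * (√(coordPairing (metricMatrix e) (f ∘ e.symm) (f ∘ e.symm) y)
        ^ (p - 2) * coordPairing (metricMatrix e) (f ∘ e.symm) ψ y) := by
    intro y hy
    rw [pFlux_eq he p hy (hf.mdifferentiableAt two_ne_zero) (hφ.mdifferentiableAt (by simp))]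
    congr 2
    refine congrArg _ (funext fun j ↦ partialDeriv_congr j ?_)
    exact (hψφ.eventuallyEq_of_mem (e.open_target.mem_nhds hy)).symm
  obtain ⟨h1, h2⟩ := integral_riemannianVolume_of_support he (h := pFlux n p f φ)
    (fun x hx ↦ pFlux_eq_zero_of_notMem_tsupport fun h ↦ hx (hφe h))
    (hint.integrableOn.congr_fun (fun y hy ↦ (hflux y hy).symm) e.open_target.measurableSet)
  refine ⟨h1, h2.trans_le ?_⟩
  rw [setIntegral_congr_fun e.open_target.measurableSet hflux,
    setIntegral_eq_integral_of_forall_compl_eq_zero]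
  · exact hle
  · intro y hy
    have h0 : coordPairing (metricMatrix e) (f ∘ e.symm) ψ y = 0 := by
      simp [coordPairing, dotProduct,
        partialDeriv_eq_zero_of_notMem_tsupport fun h ↦ hy (hψe h)]
    rw [h0, mul_zero, mul_zero]

/-- A convex function of class `C²` is `p`-subharmonic for every `p > 1`. -/
theorem IsConvex.isPSubharmonic [T2Space M] (hf : ContMDiff (𝓡 n) 𝓘(ℝ, ℝ) 2 f)
    (hconv : IsConvex n f) (hp : 1 < p) : IsPSubharmonic n p f := by
  intro φ hφ hφc hφ0
  have : LocallyCompactSpace M := ChartedSpace.locallyCompactSpace (EuclideanSpace ℝ (Fin n)) M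
  obtain ⟨ρ, hρ⟩ := SmoothPartitionOfUnity.exists_isSubordinate_chartAt_source (𝓡 n) M
  -- Local finiteness and compactness leave finitely many pieces, so no exchange of an infinite sum
  -- with the integral is needed.
  have hfin : {i | (Function.support (ρ i) ∩ tsupport φ).Nonempty}.Finite :=
    ρ.locallyFinite.finite_nonempty_inter_compact hφc.isCompact
  have hsum : φ = ∑ i ∈ hfin.toFinset, fun x ↦ ρ i x * φ x := by
    ext x
    rw [Finset.sum_apply, ← Finset.sum_mul]
    by_cases hx : x ∈ tsupport φ
    · have h1 := ρ.sum_eq_one (Set.mem_univ x)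
      rw [finsum_eq_sum_of_support_subset (s := hfin.toFinset) _ fun i hi ↦ by
        simpa using ⟨x, hi, hx⟩] at h1
      rw [h1, one_mul]
    · rw [image_eq_zero_of_notMem_tsupport hx, mul_zero]
  have hsmooth : ∀ i, ContMDiff (𝓡 n) 𝓘(ℝ, ℝ) ∞ fun x ↦ ρ i x * φ x := fun i ↦
    (ρ i).contMDiff.mul hφ
  have hterm : ∀ i, Integrable (pFlux n p f fun x ↦ ρ i x * φ x) (riemannianVolume n M) ∧
      ∫ x, pFlux n p f (fun x ↦ ρ i x * φ x) x ∂(riemannianVolume n M) ≤ 0 := fun i ↦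
    integral_pFlux_nonpos_of_tsupport_subset_source hf hconv hp (chart_mem_atlas _ i) (hsmooth i)
      hφc.mul_left ((tsupport_mul_subset_left (f := ρ i)).trans (hρ i))
      fun x ↦ mul_nonneg (ρ.nonneg i x) (hφ0 x)
  rw [hsum]
  generalize hfin.toFinset = s
  -- Smoothness of the partial sum is carried through the induction because additivity of the flux
  -- requires differentiability of both summands.
  suffices H : ContMDiff (𝓡 n) 𝓘(ℝ, ℝ) ∞ (∑ i ∈ s, fun x ↦ ρ i x * φ x) ∧
      Integrable (pFlux n p f (∑ i ∈ s, fun x ↦ ρ i x * φ x)) (riemannianVolume n M) ∧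
      ∫ x, pFlux n p f (∑ i ∈ s, fun x ↦ ρ i x * φ x) x ∂(riemannianVolume n M) ≤ 0 from H.2
  classical
  induction s using Finset.induction_on with
  | empty =>
    have h0 : pFlux n p f (0 : M → ℝ) = 0 := by
      ext x
      exact pFlux_eq_zero_of_notMem_tsupport (by simp [tsupport])
    simp only [Finset.sum_empty, h0]
    exact ⟨contMDiff_const, integrable_zero _ _ _, by simp⟩
  | insert i s hi ih =>
    obtain ⟨hs, hsi, hsn⟩ := ih
    rw [Finset.sum_insert hi]
    have hadd : pFlux n p f ((fun x ↦ ρ i x * φ x) + ∑ i ∈ s, fun x ↦ ρ i x * φ x)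
        = pFlux n p f (fun x ↦ ρ i x * φ x) + pFlux n p f (∑ i ∈ s, fun x ↦ ρ i x * φ x) :=
      funext fun x ↦ pFlux_add ((hsmooth i).mdifferentiableAt (by simp))
        (hs.mdifferentiableAt (by simp))
    rw [hadd]
    refine ⟨(hsmooth i).add hs, (hterm i).1.add hsi, ?_⟩
    rw [integral_add' (hterm i).1 hsi]
    exact add_nonpos (hterm i).2 hsn

end WeakInequality

end RiemannianPLaplace

end

theorem theorem1p1 (n : ℕ) (M : Type*) [TopologicalSpace M] [T2Space M]
    [SecondCountableTopology M] [ChartedSpace (EuclideanSpace ℝ (Fin n)) M]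
    [IsManifold (𝓡 n) ∞ M]
    [RiemannianBundle (fun x : M ↦ TangentSpace (𝓡 n) x)]
    [IsContMDiffRiemannianBundle (𝓡 n) ∞ (EuclideanSpace ℝ (Fin n))
      (fun x : M ↦ TangentSpace (𝓡 n) x)]
    [MeasurableSpace M] [BorelSpace M]
    (f : M → ℝ) (hf : ContMDiff (𝓡 n) 𝓘(ℝ, ℝ) 2 f)
    (hconv : RiemannianPLaplace.IsConvex n f) (p : ℝ) (hp : 1 < p) :
    RiemannianPLaplace.IsPSubharmonic n p f :=
  RiemannianPLaplace.IsConvex.isPSubharmonic hf hconv hp
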